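/- Let $\mathbb{T}_d$ be the rooted $d$-regular tree. A *factor* on $\mathbb{T}_d$ is a Borel measurable function $f:[0,1]^{\mathbb{T}_d}\to\{0,1\}$ that is invariant under all root preserving automorphisms of $\mathbb{T}_d$, where an automorphism $\phi$ acts on labellings by $(\phi\cdot x)(v)=x(\phi^{-1}(v))$. It assigns to a labelling $x$ the vertex set $I_f(x)$ that contains $v$ if and only if $f(\phi_v\cdot x)=1$, where $\phi_v$ is any automorphism of $\mathbb{T}_d$ mapping $v$ to the root. If the coordinates of $X$ are i.i.d. uniform on $[0,1]$ and $I_f(X)$ is almost surely an independent set of $\mathbb{T}_d$, then $I_f(X)$ is called a factor of i.i.d. independent set. For every $d$ let $f_d$ be a factor on $\mathbb{T}_d$ that generates a factor of i.i.d. independent set. For $p\in[0,1]$ let $S$ be the random set of vertices of $\mathbb{T}_d$ that contains every vertex independently with probability $p$, and let $X_0,X_1,X_2,\dots$ be labellings of $\mathbb{T}_d$ with i.i.d. uniform $[0,1]$ coordinates, independent of each other and of $S$. For $i\ge 1$ let $I_{d,i}$ be the independent set generated by $f_d$ from the labelling that equals $X_0(v)$ for $v\notin S$ and $X_i(v)$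 for $v\in S$. For $d\ge 2$ and $i\ge 1$ define $\alpha_{i,d,p}$ by $$\alpha_{i,d,p}\,\frac{\log d}{d}=\mathbb{P}\big(\mathrm{root}\in I_{d,1}\cap\dots\cap I_{d,i}\big).$$ **Theorem.** For each $k\ge 1$, $$\liminf_{d\to\infty}\ \inf_{p\in[0,1]}\ \sum_{i=1}^{k}(-1)^{i-1}\binom{k}{i}\,\alpha_{i,d,p}\,(2-\alpha_{i,d,p})\ \ge\ 0 .$$ -/

import Mathlib

open MeasureTheory ProbabilityTheory Filter

noncomputable section

namespace FIID

/-- Vertices of the `d`-regular tree `𝕋_d`: words over `d` letters in which no two consecutive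
letters agree.  The word records the edge colours met on the way from the root. -/
abbrev Vertex (d : ℕ) : Type := {w : List (Fin d) // w.IsChain (· ≠ ·)}

/-- The root of `𝕋_d` is the empty word. -/
def root (d : ℕ) : Vertex d := ⟨[], List.isChain_nil⟩

/-- The `d`-regular tree `𝕋_d`: two words are adjacent when one of them is obtained from the other
by appending one letter. -/
def tree (d : ℕ) : SimpleGraph (Vertex d) where
  Adj v w := (∃ a, w.1 = v.1 ++ [a]) ∨ (∃ a, v.1 = w.1 ++ [a])
  symm := ⟨fun _ _ h => h.symm⟩
  loopless := ⟨fun v h => by rcases h with ⟨a, h⟩ | ⟨a, h⟩ <;> simp at h⟩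

/-- Labellings `x ∈ [0,1]^{𝕋_d}`, with the product (Borel) `σ`-algebra. -/
abbrev Labelling (d : ℕ) : Type := Vertex d → unitInterval

/-- The action of a graph automorphism on labellings: `(φ · x)(v) = x (φ⁻¹ v)`. -/
def relabel {d : ℕ} (φ : tree d ≃g tree d) (x : Labelling d) : Labelling d :=
  fun v => x (φ.symm v)

/-- The law of a random labelling: i.i.d. uniform labels on `[0,1]`. -/
def labelLaw (d : ℕ) : Measure (Labelling d) :=
  Measure.infinitePi fun _ : Vertex d => (volume : Measure unitInterval)

/-- A factor on `𝕋_d`: a measurable `{0,1}`-valued function of the labelling that is invariant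
under all root preserving automorphisms. -/
structure IsFactor {d : ℕ} (f : Labelling d → Bool) : Prop where
  measurable : Measurable f
  invariant : ∀ φ : tree d ≃g tree d, φ (root d) = root d → ∀ x, f (relabel φ x) = f x

/-- The set `I` produced by a factor `f` from the labelling `x`: `v ∈ I` if and only if
`f (φ · x) = 1`, where `φ` is an automorphism that maps `v` to the root.  Such a `φ` exists, and
for a factor `f` the value does not depend on it, see `mem_process_iff`. -/
def process {d : ℕ} (f : Labelling d → Bool) (x : Labelling d) : Set (Vertex d) :=
  {v | ∃ φ : tree d ≃g tree d, φ v = root d ∧ f (relabel φ x) = true}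

/-- `f` is a factor whose process is almost surely an independent set of `𝕋_d`. -/
structure IsIndepFactor {d : ℕ} (f : Labelling d → Bool) : Prop extends IsFactor f where
  indep : ∀ᵐ x ∂labelLaw d, (tree d).IsIndepSet (process f x)

/-- The randomness behind the correlated copies: independent random labellings `X₀, X₁, X₂, …`
and, independent of them, a Bernoulli percolation `S` of density `p` on the vertices. -/
def couplingLaw (d : ℕ) (p : unitInterval) : Measure ((ℕ → Labelling d) × Set (Vertex d)) :=
  (Measure.infinitePi fun _ : ℕ => labelLaw d).prod (setBernoulli Set.univ p)

open Classical in
/-- The labelling of the `i`-th copy: `X₀` off `S` and `Xᵢ` on `S`. -/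
def copyLabelling {d : ℕ} (ω : (ℕ → Labelling d) × Set (Vertex d)) (i : ℕ) : Labelling d :=
  fun v => if v ∈ ω.2 then ω.1 i v else ω.1 0 v

/-- The `i`-th correlated copy `I_{d,i}`. -/
def copy {d : ℕ} (f : Labelling d → Bool) (ω : (ℕ → Labelling d) × Set (Vertex d)) (i : ℕ) :
    Set (Vertex d) :=
  process f (copyLabelling ω i)

/-- The density of `I_{d,1} ∩ ⋯ ∩ I_{d,i}`: the probability that it contains the root. -/
def interDensity {d : ℕ} (f : Labelling d → Bool) (p : unitInterval) (i : ℕ) : ℝ :=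
  (couplingLaw d p).real {ω | root d ∈ ⋂ j ∈ Finset.Icc 1 i, copy f ω j}

/-- The normalized intersection density `α_{i,d,p}`, so that `α_{i,d,p} (log d)/d` is the density
of the intersection of `i` copies (for `d ≥ 2`). -/
def alpha {d : ℕ} (f : Labelling d → Bool) (p : unitInterval) (i : ℕ) : ℝ :=
  interDensity f p i / (Real.log d / d)

/-! `𝕋_d` is a vertex transitive `d`-regular tree, so that `process` is well defined. -/

/-- The map underlying the reflection of `𝕋_d` in the edge from the root to the word `[a]`. -/
def flipFun {d : ℕ} (a : Fin d) : Vertex d → Vertex d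
  | ⟨[], _⟩ => ⟨[a], List.isChain_singleton _⟩
  | ⟨b :: t, h⟩ => if hb : b = a then ⟨t, h.tail⟩ else
      ⟨a :: b :: t, List.isChain_cons_cons.2 ⟨Ne.symm hb, h⟩⟩

theorem flipFun_flipFun {d : ℕ} (a : Fin d) (v : Vertex d) : flipFun a (flipFun a v) = v := by
  obtain ⟨l, h⟩ := v
  match l, h with
  | [], _ => simp [flipFun]
  | b :: t, h =>
    by_cases hb : b = a
    · subst hb
      match t, h with
      | [], _ => simp [flipFun]
      | c :: t, h =>
        have : c ≠ b := ((List.isChain_cons_cons.1 h).1).symm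
        simp [flipFun, this]
    · simp [flipFun, hb]

theorem flipFun_adj {d : ℕ} (a : Fin d) {v w : Vertex d} (h : (tree d).Adj v w) :
    (tree d).Adj (flipFun a v) (flipFun a w) := by
  have key : ∀ v w : Vertex d, (∃ c, w.1 = v.1 ++ [c]) →
      (tree d).Adj (flipFun a v) (flipFun a w) := by
    rintro ⟨l, h⟩ ⟨l', h'⟩ ⟨c, hc⟩
    dsimp only at hc
    subst hc
    match l, h with
    | [], _ =>
      by_cases hc : c = a
      · subst hc; right; exact ⟨c, by simp [flipFun]⟩
      · left; exact ⟨c, by simp [flipFun, hc]⟩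
    | b :: t, h =>
      by_cases hb : b = a
      · left; exact ⟨c, by simp [flipFun, hb]⟩
      · left; exact ⟨c, by simp [flipFun, hb]⟩
  rcases h with h | h
  · exact key v w h
  · exact (key w v h).symm

/-- The reflection of `𝕋_d` in the edge from the root to the word `[a]`. -/
def edgeFlip {d : ℕ} (a : Fin d) : tree d ≃g tree d where
  toFun := flipFun a
  invFun := flipFun a
  left_inv := flipFun_flipFun a
  right_inv := flipFun_flipFun a
  map_rel_iff' := by
    intro v w
    refine ⟨fun h => ?_, flipFun_adj a⟩
    have := flipFun_adj a h
    simpa [flipFun_flipFun] using this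

theorem edgeFlip_apply {d : ℕ} (a : Fin d) (v : Vertex d) : edgeFlip a v = flipFun a v := rfl

theorem exists_map_root {d : ℕ} (v : Vertex d) : ∃ φ : tree d ≃g tree d, φ v = root d := by
  obtain ⟨l, h⟩ := v
  induction l with
  | nil => exact ⟨SimpleGraph.Iso.refl, rfl⟩
  | cons a t ih =>
    obtain ⟨φ, hφ⟩ := ih h.tail
    refine ⟨(edgeFlip a).trans φ, ?_⟩
    have : edgeFlip a (⟨a :: t, h⟩ : Vertex d) = ⟨t, h.tail⟩ := by
      rw [edgeFlip_apply]
      simp [flipFun]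
    rw [RelIso.trans_apply, this, hφ]

theorem mem_process_iff {d : ℕ} {f : Labelling d → Bool} (hf : IsFactor f) {v : Vertex d}
    (φ : tree d ≃g tree d) (hφ : φ v = root d) (x : Labelling d) :
    v ∈ process f x ↔ f (relabel φ x) = true := by
  refine ⟨?_, fun h => ⟨φ, hφ, h⟩⟩
  rintro ⟨ψ, hψ, h⟩
  have := hf.invariant (ψ.symm.trans φ)
    (by change φ (ψ.symm (root d)) = _; rw [← hψ, RelIso.symm_apply_apply, hψ, hφ]) (relabel ψ x)
  rw [← h, ← this]
  congr 1
  funext u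
  change x (φ.symm u) = x (ψ.symm (ψ (φ.symm u)))
  simp

theorem tree_isTree (d : ℕ) : (tree d).IsTree := by
  have hr : ∀ (l : List (Fin d)) (h : l.IsChain (· ≠ ·)),
      (tree d).Reachable (root d) ⟨l, h⟩ := by
    intro l
    induction l using List.reverseRecOn with
    | nil => exact fun _ => SimpleGraph.Reachable.refl _
    | append_singleton t a ih =>
      intro h
      have ht : t.IsChain (· ≠ ·) := h.left_of_append
      exact (ih ht).trans (SimpleGraph.Adj.reachable (Or.inl ⟨a, rfl⟩))
  have : Nonempty (Vertex d) := ⟨root d⟩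
  refine ⟨⟨fun v w => (hr v.1 v.2).symm.trans (hr w.1 w.2)⟩, ?_⟩
  have key : ∀ (v w : Vertex d) (a : Fin d), w.1 = v.1 ++ [a] → (tree d).IsBridge s(w, v) := by
    intro v w a hw
    rw [SimpleGraph.isBridge_iff]
    rintro ⟨p⟩
    have : ∀ (u u' : Vertex d) (q : ((tree d).deleteEdges {s(w, v)}).Walk u u'),
        w.1 <+: u.1 → w.1 <+: u'.1 := by
      intro u u' q
      induction q with
      | nil => exact id
      | @cons u₁ u₂ _ hadj _ ih =>
        intro hu
        apply ih
        rw [SimpleGraph.deleteEdges_adj] at hadj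
        obtain ⟨hadj, hne⟩ := hadj
        rcases hadj with ⟨c, hc⟩ | ⟨c, hc⟩
        · rw [hc]; exact hu.trans (List.prefix_append _ _)
        · rw [hc, List.prefix_concat_iff] at hu
          rcases hu with hu | hu
          · exfalso
            apply hne
            have h1 : u₁ = w := Subtype.ext (hc.trans hu.symm)
            have h2 : u₂ = v := Subtype.ext (by
              rw [hw] at hu
              exact (List.append_inj_left' hu rfl).symm)
            rw [h1, h2]; rfl
          · exact hu
    have h1 := (this _ _ p List.prefix_rfl).length_le
    rw [hw] at h1
    simp at h1
  rw [SimpleGraph.isAcyclic_iff_forall_isBridge]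
  intro e
  induction e with
  | _ v w =>
    intro h
    rcases h with ⟨a, h⟩ | ⟨a, h⟩
    · rw [Sym2.eq_swap]; exact key v w a h
    · exact key w v a h

theorem tree_ncard_neighborSet {d : ℕ} (v : Vertex d) : ((tree d).neighborSet v).ncard = d := by
  obtain ⟨φ, hφ⟩ := exists_map_root v
  have h1 : ((tree d).neighborSet v).ncard = ((tree d).neighborSet (root d)).ncard := by
    rw [← hφ, ← Nat.card_coe_set_eq, ← Nat.card_coe_set_eq]
    exact Nat.card_congr (φ.mapNeighborSet v)
  have h2 : (tree d).neighborSet (root d) =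
      Set.range fun a : Fin d => (⟨[a], List.isChain_singleton _⟩ : Vertex d) := by
    ext w
    simp only [SimpleGraph.mem_neighborSet, Set.mem_range]
    constructor
    · rintro (⟨a, h⟩ | ⟨a, h⟩)
      · exact ⟨a, Subtype.ext (by simpa [root] using h.symm)⟩
      · simp [root] at h
    · rintro ⟨a, rfl⟩
      exact Or.inl ⟨a, rfl⟩
  rw [h1, h2, ← Nat.card_coe_set_eq, Nat.card_range_of_injective, Nat.card_fin]
  intro a b h
  simpa using congrArg Subtype.val h

end FIID

end

noncomputable section

set_option linter.unusedSectionVars false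

namespace FIID

/-! Collected site by site, the whole coupling is one i.i.d. labelling, so the set of those among
the first `k` copies that contain the root is a single factor of i.i.d. `F` with finitely many
values. Let `π S` be the probability of the colour `S`. Each copy is independent, so adjacent
vertices almost surely carry disjoint colours, and the mutual information along an edge is at least
`B`, the sum of `π S * π T` over intersecting `S`, `T` (`ent_pair_le_sub`). The edge-vertex
inequality (`edge_vertex`) bounds `(2d - 2) H(F)` by the sum of the `d` edge entropies, hence by `d
(2 H(F) - B)`. The leading terms cancel and leave `d B ≤ 2 H(F)`.

With `π S = β S * log d / d`, the entropy is at most `(log d)² / d` times `∑_{S ≠ ∅} β S + O_k(1 /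
log d)`. So the sum of `β S * β T` over intersecting pairs exceeds `2 ∑_{S ≠ ∅} β S` by at most
`O_k(1 / log d)` (`normalized_bound`). By inclusion-exclusion the difference of these two sums is
the alternating sum of the theorem (`sum_choose_eq`). The error depends only on `k` and `d`, hence
the uniformity in `p`.

The edge-vertex inequality is proved on a finite edge-coloured graph that looks like the tree up to
radius `r + 1`, with an independent seed at each vertex. The seeds are revealed one at a time. The
information gained on an edge is at least the gain at either end, and the vertices that a seed
influences span a forest, where the edge maxima are large enough (`sum_max_ge_of_parent`).
Discretizing the labels and approximating in measure extends the inequality to all measurable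
factors. -/

/-- The Shannon entropy of a random variable with finitely many values. -/
def ent {Ω α : Type*} [MeasurableSpace Ω] [Fintype α] (μ : Measure Ω) (X : Ω → α) : ℝ :=
  ∑ a, Real.negMulLog (μ.real (X ⁻¹' {a}))

/-! ### Shannon entropy and submodularity -/

section Entropy

variable {Ω α β γ : Type*} [MeasurableSpace Ω] [Fintype α] [Fintype β] [Fintype γ]

theorem ent_comp_injective (μ : Measure Ω) (X : Ω → α) {φ : α → β} (hφ : Function.Injective φ) :
    ent μ (fun ω => φ (X ω)) = ent μ X := by
  symm
  refine Fintype.sum_of_injective φ hφ _ _ ?_ ?_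
  · intro b hb
    have : (fun ω => φ (X ω)) ⁻¹' {b} = ∅ := by
      ext ω
      simp only [Set.mem_preimage, Set.mem_singleton_iff, Set.mem_empty_iff_false, iff_false]
      exact fun h => hb ⟨_, h⟩
    rw [this]; simp
  · intro a
    congr 2
    ext ω
    simp [hφ.eq_iff]

theorem ent_swap (μ : Measure Ω) (X : Ω → α) (Y : Ω → β) :
    ent μ (fun ω => (X ω, Y ω)) = ent μ (fun ω => (Y ω, X ω)) :=
  ent_comp_injective μ (fun ω => (Y ω, X ω)) (φ := Prod.swap) Prod.swap_injective

theorem ent_right_comm (μ : Measure Ω) (X : Ω → α) (Y : Ω → β) (Z : Ω → γ) :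
    ent μ (fun ω => ((X ω, Y ω), Z ω)) = ent μ (fun ω => ((X ω, Z ω), Y ω)) :=
  ent_comp_injective μ (fun ω => ((X ω, Z ω), Y ω)) (φ := fun p => ((p.1.1, p.2), p.1.2))
    (by rintro ⟨⟨_, _⟩, _⟩ ⟨⟨_, _⟩, _⟩ h; simp_all)

theorem ent_right_comm_snd {δ : Type*} [Fintype δ] (μ : Measure Ω) (W : Ω → δ) (X : Ω → α)
    (Y : Ω → β) (Z : Ω → γ) :
    ent μ (fun ω => (W ω, (X ω, Y ω), Z ω)) = ent μ (fun ω => (W ω, (X ω, Z ω), Y ω)) :=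
  ent_comp_injective μ (fun ω => (W ω, (X ω, Z ω), Y ω))
    (φ := fun p => (p.1, (p.2.1.1, p.2.2), p.2.1.2))
    (by rintro ⟨_, ⟨_, _⟩, _⟩ ⟨_, ⟨_, _⟩, _⟩ h; simp_all)

theorem ent_swap_snd (μ : Measure Ω) (X : Ω → α) (Y : Ω → β) (Z : Ω → γ) :
    ent μ (fun ω => (X ω, Y ω, Z ω)) = ent μ (fun ω => (X ω, Z ω, Y ω)) :=
  ent_comp_injective μ (fun ω => (X ω, Z ω, Y ω)) (φ := fun p => (p.1, p.2.2, p.2.1))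
    (by rintro ⟨_, _, _⟩ ⟨_, _, _⟩ h; simp_all)

theorem sum_real_preimage_pair {μ : Measure Ω} [IsFiniteMeasure μ] {X : Ω → α} {Y : Ω → β}
    (hm : ∀ p, MeasurableSet ((fun ω => (X ω, Y ω)) ⁻¹' {p})) (a : α) :
    ∑ b, μ.real ((fun ω => (X ω, Y ω)) ⁻¹' {(a, b)}) = μ.real (X ⁻¹' {a}) := by
  classical
  have := sum_measureReal_preimage_singleton (μ := μ) (f := fun ω => (X ω, Y ω))
    ({a} ×ˢ (Finset.univ : Finset β)) (fun p _ => hm p)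
  rw [Finset.sum_product, Finset.sum_singleton] at this
  rw [this]
  congr 1
  ext ω
  simp [eq_comm]

theorem sum_real_preimage_pair' {μ : Measure Ω} [IsFiniteMeasure μ] {X : Ω → α} {Y : Ω → β}
    (hm : ∀ p, MeasurableSet ((fun ω => (X ω, Y ω)) ⁻¹' {p})) (b : β) :
    ∑ a, μ.real ((fun ω => (X ω, Y ω)) ⁻¹' {(a, b)}) = μ.real (Y ⁻¹' {b}) := by
  classical
  have := sum_measureReal_preimage_singleton (μ := μ) (f := fun ω => (X ω, Y ω))
    ((Finset.univ : Finset α) ×ˢ {b}) (fun p _ => hm p)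
  rw [Finset.sum_product] at this
  simp only [Finset.sum_singleton] at this
  rw [this]
  congr 1
  ext ω
  simp [eq_comm]

theorem sum_real_preimage {μ : Measure Ω} [IsProbabilityMeasure μ] {X : Ω → α}
    (hm : ∀ a, MeasurableSet (X ⁻¹' {a})) : ∑ a, μ.real (X ⁻¹' {a}) = 1 := by
  have := sum_measureReal_preimage_singleton (μ := μ) (f := X) Finset.univ (fun p _ => hm p)
  rw [this]
  simp

/-- This is `1 - 1/t ≤ log t` at `t = p / q`; summed over atoms it becomes Gibbs' inequality. The
hypothesis `h` is absolute continuity, needed because `Real.log 0 = 0`. -/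
theorem mul_log_ratio_ge {p q : ℝ} (hp : 0 ≤ p) (hq : 0 ≤ q) (h : q = 0 → p = 0) :
    p - q ≤ p * (Real.log p - Real.log q) := by
  rcases hp.eq_or_lt with rfl | hp
  · simp [hq]
  have hq' : 0 < q := lt_of_le_of_ne hq fun h' => hp.ne' (h h'.symm)
  have := Real.one_sub_inv_le_log_of_pos (div_pos hp hq')
  rw [Real.log_div hp.ne' hq'.ne', inv_div] at this
  have h2 := mul_le_mul_of_nonneg_left this hp.le
  rwa [mul_sub, mul_one, mul_div_cancel₀ _ hp.ne'] at h2

/-- Conditional mutual information is nonnegative: Gibbs' inequality compares `p` with `u x y * v y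
z / w y`, the law with the same `(x, y)` and `(y, z)` marginals that makes `x` and `z` conditionally
independent given `y`. -/
theorem sum_submodular (p : α → β → γ → ℝ) (hp : ∀ x y z, 0 ≤ p x y z) :
    ∑ x, ∑ y, ∑ z, Real.negMulLog (p x y z) + ∑ y, Real.negMulLog (∑ x, ∑ z, p x y z) ≤
      ∑ x, ∑ y, Real.negMulLog (∑ z, p x y z) + ∑ y, ∑ z, Real.negMulLog (∑ x, p x y z) := by
  set u : α → β → ℝ := fun x y => ∑ z, p x y z with hu
  set v : β → γ → ℝ := fun y z => ∑ x, p x y z with hv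
  set w : β → ℝ := fun y => ∑ x, ∑ z, p x y z with hw
  have hu0 : ∀ x y, 0 ≤ u x y := fun x y => Finset.sum_nonneg fun z _ => hp x y z
  have hv0 : ∀ y z, 0 ≤ v y z := fun y z => Finset.sum_nonneg fun x _ => hp x y z
  have hw0 : ∀ y, 0 ≤ w y := fun y => Finset.sum_nonneg fun x _ => hu0 x y
  have hpu : ∀ x y z, p x y z ≤ u x y := fun x y z =>
    Finset.single_le_sum (f := fun z => p x y z) (fun z _ => hp x y z) (Finset.mem_univ z)
  have hpv : ∀ x y z, p x y z ≤ v y z := fun x y z =>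
    Finset.single_le_sum (f := fun x => p x y z) (fun x _ => hp x y z) (Finset.mem_univ x)
  have huw : ∀ x y, u x y ≤ w y := fun x y =>
    Finset.single_le_sum (f := fun x => u x y) (fun x _ => hu0 x y) (Finset.mem_univ x)
  have hvw : ∀ y, ∑ z, v y z = w y := fun y => Finset.sum_comm
  have key : ∀ x y z, p x y z - u x y * v y z / w y ≤
      p x y z * (Real.log (p x y z) + Real.log (w y) - Real.log (u x y) - Real.log (v y z)) := by
    intro x y z
    have h1 := mul_log_ratio_ge (hp x y z)
      (div_nonneg (mul_nonneg (hu0 x y) (hv0 y z)) (hw0 y)) ?_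
    · refine h1.trans (le_of_eq ?_)
      rcases (hp x y z).eq_or_lt with h | h
      · rw [← h]; simp
      have a1 : u x y ≠ 0 := (h.trans_le (hpu x y z)).ne'
      have a2 : v y z ≠ 0 := (h.trans_le (hpv x y z)).ne'
      have a3 : w y ≠ 0 := ((h.trans_le (hpu x y z)).trans_le (huw x y)).ne'
      rw [Real.log_div (mul_ne_zero a1 a2) a3, Real.log_mul a1 a2]
      ring
    · intro h
      by_contra hne
      have h : 0 < p x y z := lt_of_le_of_ne (hp x y z) (Ne.symm hne)
      have a1 : u x y ≠ 0 := (h.trans_le (hpu x y z)).ne'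
      have a2 : v y z ≠ 0 := (h.trans_le (hpv x y z)).ne'
      have a3 : w y ≠ 0 := ((h.trans_le (hpu x y z)).trans_le (huw x y)).ne'
      simp_all
  have hsum := Finset.sum_le_sum fun x (_ : x ∈ Finset.univ) => Finset.sum_le_sum fun y
    (_ : y ∈ Finset.univ) => Finset.sum_le_sum fun z (_ : z ∈ Finset.univ) => key x y z
  have hL : ∑ x, ∑ y, ∑ z, (p x y z - u x y * v y z / w y) = 0 := by
    have e1 : ∀ x y, ∑ z, u x y * v y z / w y = u x y := by
      intro x y
      rw [← Finset.sum_div, ← Finset.mul_sum, hvw]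
      by_cases h : w y = 0
      · have : u x y = 0 := le_antisymm (h ▸ huw x y) (hu0 x y)
        simp [this]
      · field_simp
    simp only [Finset.sum_sub_distrib, e1]
    simp [hu]
  have hR : ∑ x, ∑ y, ∑ z,
      p x y z * (Real.log (p x y z) + Real.log (w y) - Real.log (u x y) - Real.log (v y z)) =
      - ∑ x, ∑ y, ∑ z, Real.negMulLog (p x y z) - ∑ y, Real.negMulLog (w y)
      + ∑ x, ∑ y, Real.negMulLog (u x y) + ∑ y, ∑ z, Real.negMulLog (v y z) := by
    have e1 : ∑ y, Real.negMulLog (w y) = - ∑ x, ∑ y, ∑ z, p x y z * Real.log (w y) := by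
      rw [Finset.sum_comm, ← Finset.sum_neg_distrib]
      refine Finset.sum_congr rfl fun y _ => ?_
      simp only [← Finset.sum_mul]
      rw [Real.negMulLog]; ring
    have e2 : ∑ x, ∑ y, Real.negMulLog (u x y) = - ∑ x, ∑ y, ∑ z, p x y z * Real.log (u x y) := by
      simp only [← Finset.sum_neg_distrib, ← Finset.sum_mul, Real.negMulLog, hu]
      simp only [Finset.sum_mul, Finset.sum_neg_distrib, neg_mul]
    have e3 : ∑ y, ∑ z, Real.negMulLog (v y z) = - ∑ x, ∑ y, ∑ z, p x y z * Real.log (v y z) := by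
      have : ∑ x, ∑ y, ∑ z, p x y z * Real.log (v y z) =
          ∑ y, ∑ z, v y z * Real.log (v y z) := by
        refine Finset.sum_comm.trans (Finset.sum_congr rfl fun y _ => ?_)
        refine Finset.sum_comm.trans (Finset.sum_congr rfl fun z _ => ?_)
        rw [Finset.sum_mul]
      rw [this]
      simp only [← Finset.sum_neg_distrib, Real.negMulLog, neg_mul]
    have e4 : ∑ x, ∑ y, ∑ z, Real.negMulLog (p x y z)
        = - ∑ x, ∑ y, ∑ z, p x y z * Real.log (p x y z) := by
      simp only [← Finset.sum_neg_distrib, Real.negMulLog, neg_mul]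
    rw [e1, e2, e3, e4]
    simp only [mul_sub, mul_add, Finset.sum_sub_distrib, Finset.sum_add_distrib]
    ring
  rw [hL, hR] at hsum
  linarith

variable [DiscreteMeasurableSpace Ω] {μ : Measure Ω} [IsProbabilityMeasure μ]

theorem ent_submodular (X : Ω → α) (Y : Ω → β) (Z : Ω → γ) :
    ent μ (fun ω => (X ω, Y ω, Z ω)) + ent μ Y ≤
      ent μ (fun ω => (X ω, Y ω)) + ent μ (fun ω => (Y ω, Z ω)) := by
  have h := sum_submodular (fun x y z => μ.real ((fun ω => (X ω, Y ω, Z ω)) ⁻¹' {(x, y, z)}))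
    (fun _ _ _ => measureReal_nonneg)
  have e1 : ∀ y z, ∑ x, μ.real ((fun ω => (X ω, Y ω, Z ω)) ⁻¹' {(x, y, z)}) =
      μ.real ((fun ω => (Y ω, Z ω)) ⁻¹' {(y, z)}) := fun y z =>
    sum_real_preimage_pair' (Y := fun ω => (Y ω, Z ω)) (fun _ => .of_discrete) (y, z)
  have e2 : ∀ x y, ∑ z, μ.real ((fun ω => (X ω, Y ω, Z ω)) ⁻¹' {(x, y, z)}) =
      μ.real ((fun ω => (X ω, Y ω)) ⁻¹' {(x, y)}) := by
    intro x y
    rw [← sum_real_preimage_pair (X := fun ω => (X ω, Y ω)) (Y := Z) (fun _ => .of_discrete)]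
    refine Finset.sum_congr rfl fun z _ => ?_
    congr 1
    ext ω
    simp [and_assoc]
  have e3 : ∀ y, ∑ x, μ.real ((fun ω => (X ω, Y ω)) ⁻¹' {(x, y)}) = μ.real (Y ⁻¹' {y}) :=
    sum_real_preimage_pair' fun _ => .of_discrete
  simp only [e1, e2, e3] at h
  simpa only [ent, Fintype.sum_prod_type] using h

theorem ent_pair_le (X : Ω → α) (Y : Ω → β) :
    ent μ (fun ω => (X ω, Y ω)) ≤ ent μ X + ent μ Y := by
  have h := ent_submodular (μ := μ) X (fun _ => ()) Y
  rw [ent_comp_injective μ (fun ω => (X ω, Y ω)) (φ := fun p => (p.1, (), p.2))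
      (by rintro ⟨_, _⟩ ⟨_, _⟩ h; simp_all),
    ent_comp_injective μ X (φ := fun x => (x, ())) (fun _ _ h => (Prod.mk.inj h).1),
    ent_comp_injective μ Y (φ := fun y => ((), y)) (fun _ _ h => (Prod.mk.inj h).2)] at h
  have h0 : 0 ≤ ent μ (fun _ => ()) := Finset.sum_nonneg fun _ _ =>
    Real.negMulLog_nonneg measureReal_nonneg measureReal_le_one
  linarith

theorem ent_pair_of_indep (X : Ω → α) (Y : Ω → β)
    (h : ∀ a b, μ.real ((fun ω => (X ω, Y ω)) ⁻¹' {(a, b)}) =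
      μ.real (X ⁻¹' {a}) * μ.real (Y ⁻¹' {b})) :
    ent μ (fun ω => (X ω, Y ω)) = ent μ X + ent μ Y := by
  simp only [ent, Fintype.sum_prod_type, h, Real.negMulLog_mul, Finset.sum_add_distrib,
    ← Finset.sum_mul, ← Finset.mul_sum]
  rw [sum_real_preimage (fun _ => .of_discrete), sum_real_preimage (fun _ => .of_discrete)]
  ring

end Entropy

/-! ### Information carried by independent seeds -/

section Seeds

variable {G Λ α β : Type*} [Fintype G] [DecidableEq G] [Fintype Λ] [MeasurableSpace Λ]
  [DiscreteMeasurableSpace Λ] [Fintype α] [Fintype β]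

/-- The mutual information between `X` and the seeds with index in `S`. -/
def seedInfo (μ : Measure (G → Λ)) (S : Finset G) (X : (G → Λ) → α) : ℝ :=
  ent μ X + ent μ (fun z : G → Λ => S.restrict z) -
    ent μ (fun z : G → Λ => (X z, S.restrict z))

variable (ν : Measure Λ) [IsProbabilityMeasure ν]

/-- The product law of independent seeds. -/
abbrev seedLaw (G : Type*) {Λ : Type*} [MeasurableSpace Λ] (ν : Measure Λ)
    [IsProbabilityMeasure ν] : Measure (G → Λ) :=
  Measure.infinitePi fun _ : G => ν

theorem seedInfo_empty (X : (G → Λ) → α) : seedInfo (seedLaw G ν) ∅ X = 0 := by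
  have h : ent (seedLaw G ν) (fun z : G → Λ => (∅ : Finset G).restrict z) = 0 := by
    rw [ent, Fintype.sum_unique]
    have : (fun z : G → Λ => (∅ : Finset G).restrict z) ⁻¹' {default} = Set.univ := by
      ext z
      simp only [Set.mem_preimage, Set.mem_singleton_iff, Set.mem_univ, iff_true]
      exact Subsingleton.elim _ _
    rw [this]; simp
  have h2 : ent (seedLaw G ν) (fun z : G → Λ => (X z, (∅ : Finset G).restrict z)) =
      ent (seedLaw G ν) X := by
    rw [← ent_comp_injective (seedLaw G ν) X (φ := fun a =>
      (a, (default : (∅ : Finset G) → Λ))) (fun a b h => (Prod.mk.inj h).1)]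
    congr 1
    exact funext fun z => Prod.ext rfl (Subsingleton.elim _ _)
  rw [seedInfo, h, h2]; ring

theorem seedInfo_univ (X : (G → Λ) → α) : seedInfo (seedLaw G ν) Finset.univ X =
    ent (seedLaw G ν) X := by
  have hinj : Function.Injective fun z : G → Λ => (Finset.univ : Finset G).restrict z :=
    fun z z' h => funext fun g => congrFun h ⟨g, Finset.mem_univ g⟩
  rw [seedInfo, ent_comp_injective (seedLaw G ν) (fun z => z) hinj,
    ent_comp_injective (seedLaw G ν) (fun z => z)
      (φ := fun z => (X z, (Finset.univ : Finset G).restrict z))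
      (fun z z' h => hinj (Prod.mk.inj h).2)]
  ring

theorem ent_insert_seed {S : Finset G} {i : G} (X : (G → Λ) → α) :
    ent (seedLaw G ν) (fun z : G → Λ => (X z, (insert i S).restrict z)) =
      ent (seedLaw G ν) (fun z : G → Λ => ((X z, S.restrict z), z i)) := by
  rw [← ent_comp_injective (seedLaw G ν) (fun z : G → Λ => (X z, (insert i S).restrict z))
    (φ := fun p => ((p.1, fun s : S => p.2 ⟨s, Finset.mem_insert_of_mem s.2⟩),
      p.2 ⟨i, Finset.mem_insert_self i S⟩))]
  · rfl
  · rintro ⟨x, u⟩ ⟨y, v⟩ h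
    simp only [Prod.mk.injEq] at h
    obtain ⟨⟨rfl, h1⟩, h2⟩ := h
    refine Prod.ext rfl (funext ?_)
    rintro ⟨g, hg⟩
    rcases Finset.mem_insert.1 hg with rfl | hg
    · exact h2
    · exact congrFun h1 ⟨g, hg⟩

theorem ent_insert_seed' {S : Finset G} {i : G} :
    ent (seedLaw G ν) (fun z : G → Λ => (insert i S).restrict z) =
      ent (seedLaw G ν) (fun z : G → Λ => (S.restrict z, z i)) := by
  have h := ent_insert_seed ν (S := S) (i := i) (fun _ => ())
  rw [← ent_comp_injective (seedLaw G ν) (fun z : G → Λ => (insert i S).restrict z)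
      (φ := fun u => ((), u)) (fun a b h => (Prod.mk.inj h).2), h,
    ← ent_comp_injective (seedLaw G ν) (fun z : G → Λ => (S.restrict z, z i))
      (φ := fun p => (((), p.1), p.2))]
  rintro ⟨a, b⟩ ⟨c, d⟩ h
  simpa using h

/-- A random variable that does not depend on the seed `i` is independent of it. -/
theorem ent_pair_seed (W : (G → Λ) → α) (i : G)
    (hW : ∀ z z', (∀ g, g ≠ i → z g = z' g) → W z = W z') :
    ent (seedLaw G ν) (fun z => (W z, z i)) =
      ent (seedLaw G ν) W + ent (seedLaw G ν) (fun z => z i) := by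
  refine ent_pair_of_indep _ _ fun a b => ?_
  have hind : iIndepFun (fun (g : G) (z : G → Λ) => z g) (seedLaw G ν) :=
    iIndepFun_infinitePi (X := fun _ x => x) fun _ => measurable_id
  have h2 := hind.indepFun_finset ({i}ᶜ) {i} (by simp [disjoint_compl_left]) 
    (fun g => measurable_pi_apply g)
  have h3 := h2.measure_inter_preimage_eq_mul
    ((fun z (g : (({i}ᶜ : Finset G))) => z g) '' (W ⁻¹' {a})) ({fun _ => b})
    .of_discrete .of_discrete
  -- As `W` ignores the seed `i`, the event `W = a` is saturated for the projection to the other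
  -- seeds.
  have e1 : (fun (z : G → Λ) (g : (({i}ᶜ : Finset G))) => z g) ⁻¹'
      ((fun (z : G → Λ) (g : (({i}ᶜ : Finset G))) => z g) '' (W ⁻¹' {a})) = W ⁻¹' {a} := by
    refine Set.Subset.antisymm ?_ (Set.subset_preimage_image _ _)
    rintro z ⟨z', hz', h⟩
    refine (hW z z' fun g hg => ?_).trans hz'
    exact (congrFun h ⟨g, by simpa using hg⟩).symm
  have e2 : (fun (z : G → Λ) (g : (({i} : Finset G))) => z g) ⁻¹' {fun _ => b} =
      (fun z : G → Λ => z i) ⁻¹' {b} := by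
    ext z
    simp [funext_iff]
  have e3 : (fun z => (W z, z i)) ⁻¹' {(a, b)} = W ⁻¹' {a} ∩ (fun z : G → Λ => z i) ⁻¹' {b} := by
    ext z
    simp
  rw [e1, e2] at h3
  rw [e3, measureReal_def, h3, ENNReal.toReal_mul]
  rfl

variable {ν}

/-- The chain rule: since the seed `i` is independent of those in `S`, the gain is the conditional
mutual information of `X` and `z i` given the seeds in `S`. -/
theorem seedInfo_insert {S : Finset G} {i : G} (hi : i ∉ S) (X : (G → Λ) → α) :
    seedInfo (seedLaw G ν) (insert i S) X - seedInfo (seedLaw G ν) S X =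
      ent (seedLaw G ν) (fun z => z i) + ent (seedLaw G ν) (fun z => (X z, S.restrict z))
        - ent (seedLaw G ν) (fun z => ((X z, S.restrict z), z i)) := by
  rw [seedInfo, seedInfo, ent_insert_seed, ent_insert_seed', ent_pair_seed]
  · ring
  · intro z z' h
    exact funext fun g => h g fun hg => hi (hg ▸ g.2)

theorem seedInfo_insert_of_indep {S : Finset G} {i : G} (hi : i ∉ S) (X : (G → Λ) → α)
    (hX : ∀ z z', (∀ g, g ≠ i → z g = z' g) → X z = X z') :
    seedInfo (seedLaw G ν) (insert i S) X - seedInfo (seedLaw G ν) S X = 0 := by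
  rw [seedInfo_insert hi, ent_pair_seed]
  · ring
  · intro z z' h
    exact Prod.ext (hX z z' h) (funext fun g => h g fun hg => hi (hg ▸ g.2))

/-- By submodularity, observing `Y` as well can only increase what is learnt about the seed `i`.
This bounds the gain on an edge below by the gain at each of its ends. -/
theorem seedInfo_insert_mono {S : Finset G} {i : G} (hi : i ∉ S) (X : (G → Λ) → α)
    (Y : (G → Λ) → β) :
    seedInfo (seedLaw G ν) (insert i S) X - seedInfo (seedLaw G ν) S X ≤
    seedInfo (seedLaw G ν) (insert i S) (fun z => (X z, Y z)) -
      seedInfo (seedLaw G ν) S (fun z => (X z, Y z)) := by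
  rw [seedInfo_insert hi, seedInfo_insert hi]
  have h := ent_submodular (μ := seedLaw G ν) (fun z => z i) (fun z => (X z, S.restrict z)) Y
  rw [ent_swap _ (fun z => (X z, S.restrict z)), ent_right_comm, ent_swap _ (fun z => ((X z, Y z), S.restrict z)),
    ent_right_comm_snd]
  linarith

theorem seedInfo_swap (μ : Measure (G → Λ)) (S : Finset G) (X : (G → Λ) → α)
    (Y : (G → Λ) → β) :
    seedInfo μ S (fun z => (X z, Y z)) = seedInfo μ S (fun z => (Y z, X z)) := by
  have h : ent μ (fun z => ((X z, Y z), S.restrict z)) =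
      ent μ (fun z => ((Y z, X z), S.restrict z)) := by
    rw [ent_swap _ _ (fun z => S.restrict z), ent_swap_snd, ent_swap]
  rw [seedInfo, seedInfo, ent_swap _ X Y, h]

theorem seedInfo_insert_nonneg {S : Finset G} {i : G} (hi : i ∉ S) (X : (G → Λ) → α) :
    0 ≤ seedInfo (seedLaw G ν) (insert i S) X - seedInfo (seedLaw G ν) S X := by
  rw [seedInfo_insert hi]
  linarith [ent_pair_le (μ := seedLaw G ν) (fun z => (X z, S.restrict z)) (fun z => z i)]

end Seeds

/-! ### Expansion of forests and the inequality on finite graphs -/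

section Expansion

variable {G κ : Type*} [Fintype G] [Fintype κ] [DecidableEq κ]

/-- Expansion of forests, in weighted form: if each edge between two vertices of positive weight
joins one of them to its parent, then the edge maxima dominate the vertex weights. -/
theorem sum_max_ge_of_parent {s : κ → G → G} (hs : ∀ a, Function.Involutive (s a))
    (δ : G → ℝ) (hδ : ∀ g, 0 ≤ δ g) (par : G → Option κ)
    (hpar : ∀ g a, δ g ≠ 0 → δ (s a g) ≠ 0 → par g = some a ∨ par (s a g) = some a) :
    (2 * Fintype.card κ - 2) * ∑ g, δ g ≤ ∑ a, ∑ g, max (δ g) (δ (s a g)) := by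
  have hre : ∀ (a : κ) (F : G → ℝ), ∑ g, F (s a g) = ∑ g, F g := fun a F =>
    Equiv.sum_comp (hs a).toPerm F
  -- The minimum over an edge is charged to the end whose parent edge it is. Each vertex has at most
  -- one parent edge, so it is charged once in each of the two orientations.
  have hmin : ∀ a g, min (δ g) (δ (s a g)) ≤
      (if par g = some a then δ g else 0) +
        (if par (s a g) = some a then δ (s a g) else 0) := by
    intro a g
    have h0 : ∀ (P : Prop) [Decidable P] (g : G), 0 ≤ if P then δ g else 0 := fun P _ g => by
      split_ifs
      exacts [hδ g, le_rfl]
    by_cases e1 : δ g = 0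
    · exact (min_le_left _ _).trans (e1 ▸ add_nonneg (h0 _ _) (h0 _ _))
    by_cases e2 : δ (s a g) = 0
    · exact (min_le_right _ _).trans (e2 ▸ add_nonneg (h0 _ _) (h0 _ _))
    rcases hpar g a e1 e2 with h | h
    · rw [if_pos h]
      exact (min_le_left _ _).trans (le_add_of_nonneg_right (h0 _ _))
    · rw [if_pos h]
      exact (min_le_right _ _).trans (le_add_of_nonneg_left (h0 _ _))
  have hone : ∑ a, ∑ g, (if par g = some a then δ g else 0) ≤ ∑ g, δ g := by
    rw [Finset.sum_comm]
    refine Finset.sum_le_sum fun g _ => ?_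
    rcases h : par g with _ | b
    · simpa using hδ g
    · simp
  have hsum : ∑ a, ∑ g, min (δ g) (δ (s a g)) ≤ 2 * ∑ g, δ g := by
    refine (Finset.sum_le_sum fun a _ => Finset.sum_le_sum fun g _ => hmin a g).trans ?_
    simp only [Finset.sum_add_distrib]
    have := fun a => hre a fun g => if par g = some a then δ g else 0
    simp only [this]
    linarith
  have hmm : ∑ a, ∑ g, max (δ g) (δ (s a g)) =
      2 * Fintype.card κ * ∑ g, δ g - ∑ a, ∑ g, min (δ g) (δ (s a g)) := by
    rw [eq_sub_iff_add_eq]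
    simp only [← Finset.sum_add_distrib, max_add_min]
    simp only [Finset.sum_add_distrib, hre _ δ]
    simp; ring
  rw [hmm]; linarith

variable {Λ α : Type*} [DecidableEq G] [Fintype Λ] [MeasurableSpace Λ]
  [DiscreteMeasurableSpace Λ] [Fintype α] {ν : Measure Λ} [IsProbabilityMeasure ν]

/-- The edge-vertex entropy inequality for functions of independent seeds indexed by the vertices
of a finite edge-coloured graph, if each seed influences a forest. -/
theorem sum_ent_pair_ge {s : κ → G → G} (hs : ∀ a, Function.Involutive (s a))
    (X : G → (G → Λ) → α) (D : G → G → Prop)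
    (hD : ∀ g i, ¬ D g i → ∀ z z', (∀ h, h ≠ i → z h = z' h) → X g z = X g z')
    (hpar : ∀ i, ∃ par : G → Option κ, ∀ g a, D g i → D (s a g) i →
      par g = some a ∨ par (s a g) = some a) :
    (2 * Fintype.card κ - 2) * ∑ g, ent (seedLaw G ν) (X g) ≤
      ∑ a, ∑ g, ent (seedLaw G ν) (fun z => (X g z, X (s a g) z)) := by
  -- Induction over the revealed seeds; once all are revealed, the information is the full entropy.
  have key : ∀ S : Finset G, (2 * Fintype.card κ - 2) * ∑ g, seedInfo (seedLaw G ν) S (X g) ≤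
      ∑ a, ∑ g, seedInfo (seedLaw G ν) S (fun z => (X g z, X (s a g) z)) := by
    intro S
    induction S using Finset.induction_on with
    | empty => simp [seedInfo_empty]
    | insert i S hi ih =>
      obtain ⟨par, hp⟩ := hpar i
      have h := sum_max_ge_of_parent hs
        (fun g => seedInfo (seedLaw G ν) (insert i S) (X g) - seedInfo (seedLaw G ν) S (X g))
        (fun g => seedInfo_insert_nonneg hi _) par fun g a h1 h2 => hp g a
          (by_contra fun h => h1 (seedInfo_insert_of_indep hi _ (hD g i h)))
          (by_contra fun h => h2 (seedInfo_insert_of_indep hi _ (hD _ i h)))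
      have h' : ∑ a, ∑ g, max
          (seedInfo (seedLaw G ν) (insert i S) (X g) - seedInfo (seedLaw G ν) S (X g))
          (seedInfo (seedLaw G ν) (insert i S) (X (s a g)) - seedInfo (seedLaw G ν) S (X (s a g)))
          ≤ ∑ a, ∑ g, (seedInfo (seedLaw G ν) (insert i S) (fun z => (X g z, X (s a g) z)) -
            seedInfo (seedLaw G ν) S (fun z => (X g z, X (s a g) z))) := by
        refine Finset.sum_le_sum fun a _ => Finset.sum_le_sum fun g _ => max_le ?_ ?_
        · exact seedInfo_insert_mono hi _ _
        · rw [seedInfo_swap, seedInfo_swap _ S]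
          exact seedInfo_insert_mono hi _ _
      simp only [Finset.sum_sub_distrib] at h h'
      linarith
  simpa only [seedInfo_univ] using key Finset.univ

end Expansion

/-! ### Finite graphs that are locally the tree -/

section FiniteQuotient

variable {d : ℕ}

/-- The ball of radius `R` about the root. -/
abbrev Ball (d R : ℕ) : Type := {v : Vertex d // v.1.length ≤ R}

instance (d R : ℕ) : Finite (Ball d R) := by
  have := (List.finite_length_le (Fin d) R).to_subtype
  exact Finite.of_injective
    (fun v : Ball d R => (⟨v.1.1, v.2⟩ : {l : List (Fin d) | l.length ≤ R}))
    fun v w h => by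
      have h' := congrArg Subtype.val h
      exact Subtype.ext (Subtype.ext h')

/-- The reflection `flipFun a`, truncated to the ball of radius `R`. -/
def ballFlip (R : ℕ) (a : Fin d) (v : Ball d R) : Ball d R :=
  if h : (flipFun a v.1).1.length ≤ R then ⟨flipFun a v.1, h⟩ else v

theorem ballFlip_involutive (R : ℕ) (a : Fin d) : Function.Involutive (ballFlip R a) := by
  intro v
  by_cases h : (flipFun a v.1).1.length ≤ R
  · simp [ballFlip, h, flipFun_flipFun, v.2]
  · simp [ballFlip, h]

/-- The word `w` acts on the ball of radius `R` by truncated reflections. -/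
def wordPerm (R : ℕ) (w : List (Fin d)) : Equiv.Perm (Ball d R) :=
  (w.map fun a => (ballFlip_involutive R a).toPerm).prod

theorem wordPerm_cons (R : ℕ) (a : Fin d) (w : List (Fin d)) :
    wordPerm R (a :: w) = (ballFlip_involutive R a).toPerm * wordPerm R w := by
  simp [wordPerm]

theorem toPerm_mul_self (R : ℕ) (a : Fin d) :
    (ballFlip_involutive R a).toPerm * (ballFlip_involutive R a).toPerm = 1 :=
  Equiv.ext fun v => ballFlip_involutive R a v

/-- Prepending the letter `a`, or cancelling it, is left multiplication by its involution, so
passing to a neighbour in the tree becomes a group operation. -/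
theorem wordPerm_flipFun (R : ℕ) (a : Fin d) (v : Vertex d) :
    wordPerm R (flipFun a v).1 = (ballFlip_involutive R a).toPerm * wordPerm R v.1 := by
  obtain ⟨l, h⟩ := v
  match l, h with
  | [], _ => simp [flipFun, wordPerm]
  | b :: t, h =>
    by_cases hb : b = a
    · subst hb
      simp [flipFun, wordPerm_cons, ← mul_assoc, toPerm_mul_self]
    · simp [flipFun, hb, wordPerm_cons]

/-- Applied to the root, the letters build up the word from its end without leaving the ball, so the
truncation never acts. Words of length at most `R` thus give distinct permutations. -/
theorem wordPerm_root (R : ℕ) (v : Vertex d) (hv : v.1.length ≤ R) :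
    wordPerm R v.1 ⟨root d, Nat.zero_le R⟩ = ⟨v, hv⟩ := by
  obtain ⟨l, h⟩ := v
  induction l with
  | nil => rfl
  | cons a t ih =>
    have ht : t.length ≤ R := by simp at hv; omega
    rw [wordPerm_cons, Equiv.Perm.mul_apply, ih h.tail ht]
    have e : flipFun a ⟨t, h.tail⟩ = ⟨a :: t, h⟩ := by
      match t, h with
      | [], _ => rfl
      | b :: t, h =>
        have : b ≠ a := (List.isChain_cons_cons.1 h).1.symm
        simp [flipFun, this]
    change ballFlip R a _ = _
    simp only [ballFlip, e]
    exact dif_pos hv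

theorem wordPerm_injOn (R : ℕ) {v w : Vertex d} (hv : v.1.length ≤ R) (hw : w.1.length ≤ R)
    (h : wordPerm R v.1 = wordPerm R w.1) : v = w := by
  have := wordPerm_root R v hv
  rw [h, wordPerm_root R w hw] at this
  exact (congrArg Subtype.val this).symm

theorem length_flipFun_le (a : Fin d) (v : Vertex d) :
    (flipFun a v).1.length ≤ v.1.length + 1 := by
  obtain ⟨l, h⟩ := v
  match l, h with
  | [], _ => simp [flipFun]
  | b :: t, h =>
    by_cases hb : b = a
    · simp [flipFun, hb]; omega
    · simp [flipFun, hb]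

/-- One of the end vertices of an edge at a reflection has the reflecting letter as its first. -/
theorem head_or_head_flipFun (a : Fin d) (v : Vertex d) :
    v.1.head? = some a ∨ (flipFun a v).1.head? = some a := by
  obtain ⟨l, h⟩ := v
  match l, h with
  | [], _ => simp [flipFun]
  | b :: t, h =>
    by_cases hb : b = a
    · simp [hb]
    · simp [flipFun, hb]

variable {Λ α β : Type*} [MeasurableSpace Λ] [Fintype α] [Fintype β]

/-- `F` depends only on the labels in the ball of radius `r`. -/
def IsLocal (r : ℕ) (F : (Vertex d → Λ) → α) : Prop :=
  ∀ x y, (∀ v : Vertex d, v.1.length ≤ r → x v = y v) → F x = F y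

theorem IsLocal.mono {r s : ℕ} (h : r ≤ s) {F : (Vertex d → Λ) → α} (hF : IsLocal r F) :
    IsLocal s F := fun x y hxy => hF x y fun v hv => hxy v (hv.trans h)

theorem IsLocal.pair {r : ℕ} {F : (Vertex d → Λ) → α} (hF : IsLocal r F) (a : Fin d) :
    IsLocal (r + 1) fun x => (F x, F fun v => x (flipFun a v)) := by
  intro x y h
  refine Prod.ext (hF.mono r.le_succ x y h) (hF _ _ fun v hv => h _ ?_)
  exact (length_flipFun_le a v).trans (by omega)

variable [Fintype Λ] [DiscreteMeasurableSpace Λ] {ν : Measure Λ} [IsProbabilityMeasure ν]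

/-- A local function reads finitely many labels, which `e` places at distinct seeds, and both
families of labels have the same product law. -/
theorem IsLocal.law_comp {R : ℕ} {F : (Vertex d → Λ) → α} (hF : IsLocal R F) {G : Type*}
    {e : Vertex d → G}
    (he : ∀ v w : Vertex d, v.1.length ≤ R → w.1.length ≤ R → e v = e w → v = w) (b : α) :
    (Measure.infinitePi fun _ : G => ν).real ((fun z => F fun v => z (e v)) ⁻¹' {b}) =
      (Measure.infinitePi fun _ : Vertex d => ν).real (F ⁻¹' {b}) := by
  classical
  have hne : Nonempty Λ := ν.nonempty_of_neZero
  obtain ⟨c⟩ := hne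
  -- The value `c` outside the ball is never seen by `F`.
  set F' : (Ball d R → Λ) → α := fun u => F fun v => if h : v.1.length ≤ R then u ⟨v, h⟩ else c
  have h1 := Measure.map_infinitePi_infinitePi_of_inj (P := fun _ : G => ν)
    (f := fun v : Ball d R => e v.1) fun v w h => Subtype.ext (he _ _ v.2 w.2 h)
  have h2 := Measure.map_infinitePi_infinitePi_of_inj (P := fun _ : Vertex d => ν)
    (f := fun v : Ball d R => v.1) Subtype.val_injective
  have h3 := h1.trans h2.symm
  have h4 := congrArg (fun m : Measure (Ball d R → Λ) => m.real (F' ⁻¹' {b})) h3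
  rw [map_measureReal_apply (by fun_prop) .of_discrete,
    map_measureReal_apply (by fun_prop) .of_discrete] at h4
  have h5 : ∀ x, F' (fun v => x v.1) = F x := fun x => hF _ _ fun v hv => dif_pos hv
  have h6 : ∀ z : G → Λ, F' (fun v => z (e v.1)) = F fun v => z (e v) := fun z =>
    h5 fun v => z (e v)
  simp only [← h6]
  refine h4.trans ?_
  congr 1
  ext x
  simp only [Set.mem_preimage, h5]

/-- The edge-vertex entropy inequality for local functions of finitely valued labels. -/
theorem IsLocal.edge_vertex {r : ℕ} {F : (Vertex d → Λ) → α} (hF : IsLocal r F) :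
    (2 * d - 2) * ent (Measure.infinitePi fun _ : Vertex d => ν) F ≤
      ∑ a, ent (Measure.infinitePi fun _ : Vertex d => ν)
        (fun x => (F x, F fun v => x (flipFun a v))) := by
  classical
  -- The radius is `r + 1` because the pair of colours on an edge reads labels up to that distance.
  have : Fintype (Equiv.Perm (Ball d (r + 1))) := Fintype.ofFinite _
  set σ : Fin d → Equiv.Perm (Ball d (r + 1)) := fun a => (ballFlip_involutive (r + 1) a).toPerm
  -- Neighbours arise by right multiplication: `g * σ a * wordPerm v` is `g` times the permutation
  -- of `flipFun a v`.
  set s : Fin d → Equiv.Perm (Ball d (r + 1)) → Equiv.Perm (Ball d (r + 1)) :=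
    fun a g => g * σ a with hs
  have hinv : ∀ a, Function.Involutive (s a) := fun a g => by
    simp only [hs, mul_assoc]
    rw [toPerm_mul_self, mul_one]
  set X : Equiv.Perm (Ball d (r + 1)) → (Equiv.Perm (Ball d (r + 1)) → Λ) → α :=
    fun g z => F fun v => z (g * wordPerm (r + 1) v.1) with hX
  have hXs : ∀ a g z, X (s a g) z = F fun v => z (g * wordPerm (r + 1) (flipFun a v).1) := by
    intro a g z
    simp only [hX, hs, wordPerm_flipFun, mul_assoc, σ]
  have hdisj : ∀ (g : Equiv.Perm (Ball d (r + 1))) (v w : Vertex d), v.1.length ≤ r + 1 →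
      w.1.length ≤ r + 1 → g * wordPerm (r + 1) v.1 = g * wordPerm (r + 1) w.1 → v = w :=
    fun g v w hv hw h => wordPerm_injOn (r + 1) hv hw (mul_left_cancel h)
  have main := sum_ent_pair_ge (ν := ν) hinv X
    (fun g i => ∃ v : Vertex d, v.1.length ≤ r ∧ g * wordPerm (r + 1) v.1 = i) ?_ ?_
  · have e1 : ∀ g, ent (seedLaw (Equiv.Perm (Ball d (r + 1))) ν) (X g) =
        ent (Measure.infinitePi fun _ : Vertex d => ν) F := by
      intro g
      refine Finset.sum_congr rfl fun b _ => ?_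
      rw [← (hF.mono r.le_succ).law_comp (hdisj g)]
    have e2 : ∀ a g, ent (seedLaw (Equiv.Perm (Ball d (r + 1))) ν)
        (fun z => (X g z, X (s a g) z)) = ent (Measure.infinitePi fun _ : Vertex d => ν)
        (fun x => (F x, F fun v => x (flipFun a v))) := by
      intro a g
      refine Finset.sum_congr rfl fun b _ => ?_
      rw [← (hF.pair a).law_comp (hdisj g)]
      simp only [hXs]
      rfl
    simp only [e1, e2, Finset.sum_const, Finset.card_univ, Fintype.card_fin, nsmul_eq_mul,
      ← Finset.mul_sum] at main
    have hpos : (0 : ℝ) < Fintype.card (Equiv.Perm (Ball d (r + 1))) := by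
      exact_mod_cast Fintype.card_pos
    refine le_of_mul_le_mul_left ?_ hpos
    linarith
  · intro g i hi z z' h
    exact hF _ _ fun v hv => h _ fun hv' => hi ⟨v, hv, hv'⟩
  · intro i
    -- A vertex `g` influenced by the seed `i` satisfies `g * wordPerm v = i` for a short word `v`.
    -- Its parent is the next vertex on the way to `i`, so the parent edge has the first letter of
    -- `v` as colour.
    refine ⟨fun g => if h : ∃ v : Vertex d, v.1.length ≤ r ∧ g * wordPerm (r + 1) v.1 = i then
      h.choose.1.head? else none, ?_⟩
    rintro g a h h'
    beta_reduce
    rw [dif_pos h, dif_pos h']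
    have hv := h.choose_spec
    have hw := h'.choose_spec
    generalize h.choose = v at hv
    generalize h'.choose = w at hw
    -- Both words lead from `g` to `i` and have length at most `r + 1`, where words are determined
    -- by their permutations.
    have hvw : v = flipFun a w := by
      refine hdisj g _ _ (by omega) ((length_flipFun_le a w).trans (by omega)) ?_
      rw [hv.2, ← hw.2, wordPerm_flipFun, ← mul_assoc]
    rw [hvw]
    exact (head_or_head_flipFun a w).symm

end FiniteQuotient

/-! ### From local functions to measurable factors -/

section Approximation

variable {d : ℕ} {Λ : Type*} [MeasurableSpace Λ] {α β : Type*}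

/-- `F` depends only on a finitely valued measurable function of the labels in some ball. -/
def IsQuantized (F : (Vertex d → Λ) → α) : Prop :=
  ∃ (m : ℕ) (q : Λ → Fin m) (r : ℕ), Measurable q ∧
    ∀ x y, (∀ v : Vertex d, v.1.length ≤ r → q (x v) = q (y v)) → F x = F y

theorem IsQuantized.comp {F : (Vertex d → Λ) → α} (hF : IsQuantized F) (φ : α → β) :
    IsQuantized fun x => φ (F x) := by
  obtain ⟨m, q, r, hq, h⟩ := hF
  exact ⟨m, q, r, hq, fun x y hxy => congrArg φ (h x y hxy)⟩

theorem IsQuantized.const (c : α) : IsQuantized fun _ : Vertex d → Λ => c :=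
  ⟨1, fun _ => 0, 0, measurable_const, fun _ _ _ => rfl⟩

/-- Finitely many quantizers have a common refinement, their product, and the largest radius serves
all of them. -/
theorem IsQuantized.pi {ι : Type*} [Fintype ι] {F : ι → (Vertex d → Λ) → α}
    (hF : ∀ i, IsQuantized (F i)) : IsQuantized fun x i => F i x := by
  classical
  choose m q r hq h using hF
  refine ⟨_, fun x => Fintype.equivFin (∀ i, Fin (m i)) fun i => q i x, Finset.univ.sup r,
    (measurable_of_finite _).comp (measurable_pi_iff.2 hq), fun x y hxy => funext fun i => ?_⟩
  refine h i x y fun v hv => ?_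
  have := hxy v (hv.trans (Finset.le_sup (Finset.mem_univ i)))
  exact congrFun ((Fintype.equivFin _).injective this) i

theorem IsQuantized.measurableSet {F : (Vertex d → Λ) → α} (hF : IsQuantized F) (B : Set α) :
    MeasurableSet (F ⁻¹' B) := by
  obtain ⟨m, q, r, hq, h⟩ := hF
  set π : (Vertex d → Λ) → Ball d r → Fin m := fun x v => q (x v.1)
  have hπ : Measurable π := measurable_pi_iff.2 fun v => hq.comp (measurable_pi_apply _)
  have : F ⁻¹' B = π ⁻¹' (π '' (F ⁻¹' B)) := by
    refine Set.Subset.antisymm (Set.subset_preimage_image _ _) ?_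
    rintro x ⟨y, hy, hxy⟩
    have := h y x fun v hv => congrFun hxy ⟨v, hv⟩
    rwa [Set.mem_preimage, this] at hy
  rw [this]
  exact hπ .of_discrete

theorem isSetRing_quantized :
    IsSetRing {E : Set (Vertex d → Λ) | IsQuantized fun x => x ∈ E} where
  empty_mem := IsQuantized.const False
  union_mem s t hs ht := by
    have := IsQuantized.pi (ι := Bool) (F := fun b x => x ∈ cond b s t)
      (by rintro (_ | _); exacts [ht, hs])
    exact this.comp fun u => u true ∨ u false
  sdiff_mem s t hs ht := by
    have := IsQuantized.pi (ι := Bool) (F := fun b x => x ∈ cond b s t)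
      (by rintro (_ | _); exacts [ht, hs])
    exact this.comp fun u => u true ∧ ¬ u false

theorem generateFrom_quantized : (inferInstance : MeasurableSpace (Vertex d → Λ)) =
    MeasurableSpace.generateFrom {E : Set (Vertex d → Λ) | IsQuantized fun x => x ∈ E} := by
  classical
  refine le_antisymm (iSup_le fun v => ?_) (MeasurableSpace.generateFrom_le fun E hE => ?_)
  · rintro _ ⟨B, hB, rfl⟩
    refine MeasurableSpace.measurableSet_generateFrom ?_
    refine ⟨2, fun c => if c ∈ B then 0 else 1, v.1.length,
      Measurable.ite hB measurable_const measurable_const, fun x y h => propext ?_⟩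
    have := h v le_rfl
    by_cases h1 : x v ∈ B <;> by_cases h2 : y v ∈ B <;> simp_all
  · exact IsQuantized.measurableSet hE {p | p}

variable {ν : Measure Λ} [IsProbabilityMeasure ν] [Fintype α] [Fintype β]

/-- Quantized events form a ring that generates the `σ`-algebra, so each fibre of `F` is
approximated within `ε / card α`. Where all the approximations are correct, exactly one of them
contains the point. -/
theorem exists_quantized_approx [Nonempty α] {F : (Vertex d → Λ) → α}
    (hF : ∀ a, MeasurableSet (F ⁻¹' {a})) {ε : ℝ} (hε : 0 < ε) :
    ∃ F' : (Vertex d → Λ) → α, IsQuantized F' ∧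
      (Measure.infinitePi fun _ : Vertex d => ν).real {x | F x ≠ F' x} ≤ ε := by
  classical
  set μ := Measure.infinitePi fun _ : Vertex d => ν
  set δ : ℝ := ε / Fintype.card α
  have hδ : 0 < δ := div_pos hε (by exact_mod_cast Fintype.card_pos)
  have h1 : ∀ a, ∃ A ∈ {E : Set (Vertex d → Λ) | IsQuantized fun x => x ∈ E},
      μ (symmDiff A (F ⁻¹' {a})) < ENNReal.ofReal δ := fun a =>
    exists_measure_symmDiff_lt_of_generateFrom_isSetRing isSetRing_quantized
      ⟨{Set.univ}, Set.countable_singleton _, by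
        simpa using IsQuantized.const True, by simp⟩ generateFrom_quantized (hF a)
      (ENNReal.ofReal_pos.2 hδ)
  choose A hA hμ using h1
  refine ⟨fun x => if h : ∃ a, x ∈ A a then h.choose else Classical.arbitrary α, ?_, ?_⟩
  · have := IsQuantized.pi (F := fun a x => x ∈ A a) hA
    exact this.comp fun u : α → Prop => if h : ∃ a, u a then h.choose else Classical.arbitrary α
  · have hsub : {x | F x ≠ if h : ∃ a, x ∈ A a then h.choose else Classical.arbitrary α} ⊆
        ⋃ a ∈ (Finset.univ : Finset α), symmDiff (A a) (F ⁻¹' {a}) := by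
      intro x hx
      by_contra hx'
      simp only [Finset.mem_univ, Set.iUnion_true, Set.mem_iUnion, not_exists,
        Set.mem_symmDiff, Set.mem_preimage, Set.mem_singleton_iff] at hx'
      have hiff : ∀ a, x ∈ A a ↔ F x = a := fun a => by
        have := hx' a
        tauto
      apply hx
      have hex : ∃ a, x ∈ A a := ⟨F x, (hiff _).2 rfl⟩
      rw [dif_pos hex]
      exact (hiff _).1 hex.choose_spec
    refine (measureReal_mono hsub (measure_ne_top _ _)).trans ((measureReal_biUnion_finset_le _ _).trans ?_)
    have : ∀ a ∈ (Finset.univ : Finset α), μ.real (symmDiff (A a) (F ⁻¹' {a})) ≤ δ := fun a _ =>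
      ENNReal.toReal_le_of_le_ofReal hδ.le (hμ a).le
    refine (Finset.sum_le_sum this).trans (le_of_eq ?_)
    have hc : (Fintype.card α : ℝ) ≠ 0 := by exact_mod_cast Fintype.card_ne_zero
    simp only [Finset.sum_const, Finset.card_univ, nsmul_eq_mul, δ]
    field_simp

/-- Pushing the label law forward under `q` gives a finite alphabet; `Function.invFun q` picks a
representative label for each letter. -/
theorem IsQuantized.edge_vertex {F : (Vertex d → Λ) → α} (hF : IsQuantized F) :
    (2 * d - 2) * ent (Measure.infinitePi fun _ : Vertex d => ν) F ≤
      ∑ a, ent (Measure.infinitePi fun _ : Vertex d => ν)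
        (fun x => (F x, F fun v => x (flipFun a v))) := by
  obtain ⟨m, q, r, hq, h⟩ := hF
  have hne : Nonempty Λ := ν.nonempty_of_neZero
  have : IsProbabilityMeasure (ν.map q) := Measure.isProbabilityMeasure_map hq.aemeasurable
  set F' : (Vertex d → Fin m) → α := fun u => F fun v => Function.invFun q (u v) with hF'
  have hqq : ∀ c, q (Function.invFun q (q c)) = q c := fun c => Function.invFun_eq ⟨c, rfl⟩
  have hFF' : ∀ x, F' (fun v => q (x v)) = F x := fun x => h _ _ fun v _ => hqq _
  have hloc : IsLocal r F' := fun x y hxy => h _ _ fun v hv => by rw [hxy v hv]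
  have hquant : ∀ {γ : Type _} {r : ℕ} {f : (Vertex d → Fin m) → γ}, IsLocal r f →
      IsQuantized f := fun {γ r f} hf => ⟨m, id, r, measurable_id, hf⟩
  have hmap := Measure.infinitePi_map_pi (μ := fun _ : Vertex d => ν) (f := fun _ => q)
    (fun _ => hq)
  have hent : ∀ {γ : Type _} [Fintype γ] {f : (Vertex d → Fin m) → γ} {s : ℕ}, IsLocal s f →
      ent (Measure.infinitePi fun _ : Vertex d => ν.map q) f =
        ent (Measure.infinitePi fun _ : Vertex d => ν) fun x => f fun v => q (x v) := by
    intro γ _ f s hf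
    refine Finset.sum_congr rfl fun b _ => ?_
    rw [← hmap, map_measureReal_apply (by fun_prop) ((hquant hf).measurableSet _)]
    rfl
  have main := hloc.edge_vertex (ν := ν.map q)
  rw [hent hloc] at main
  simp only [fun a => hent (hloc.pair a)] at main
  have e1 : (fun x : Vertex d → Λ => F' fun v => q (x v)) = F := funext hFF'
  have e2 : ∀ a (x : Vertex d → Λ), (F' fun v => q (x (flipFun a v))) =
      F fun v => x (flipFun a v) := fun a x => hFF' fun v => x (flipFun a v)
  simpa only [e1, e2, hFF'] using main

omit [Fintype β] in
theorem abs_real_preimage_sub_le {Ω : Type*} [MeasurableSpace Ω] (μ : Measure Ω)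
    [IsFiniteMeasure μ] (X Y : Ω → β) (b : β) :
    |μ.real (X ⁻¹' {b}) - μ.real (Y ⁻¹' {b})| ≤ μ.real {ω | X ω ≠ Y ω} := by
  have key : ∀ X Y : Ω → β, μ.real (X ⁻¹' {b}) ≤ μ.real (Y ⁻¹' {b}) +
      μ.real {ω | X ω ≠ Y ω} := by
    intro X Y
    refine (measureReal_mono ?_).trans (measureReal_union_le _ _)
    intro ω hω
    by_cases h : X ω = Y ω
    · left
      rw [Set.mem_preimage, ← h]
      exact hω
    · exact Or.inr h
  have h1 := key X Y
  have h2 := key Y X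
  simp only [ne_comm (a := Y _)] at h2
  rw [abs_le]
  constructor <;> linarith

theorem tendsto_ent {Ω : Type*} [MeasurableSpace Ω] {μ : Measure Ω}
    [IsFiniteMeasure μ] {X : Ω → β} {Y : ℕ → Ω → β}
    (h : Tendsto (fun n => μ.real {ω | Y n ω ≠ X ω}) atTop (nhds 0)) :
    Tendsto (fun n => ent μ (Y n)) atTop (nhds (ent μ X)) := by
  refine tendsto_finsetSum _ fun b _ => (Real.continuous_negMulLog.tendsto _).comp ?_
  rw [tendsto_iff_norm_sub_tendsto_zero]
  exact squeeze_zero (fun _ => norm_nonneg _) (fun n => abs_real_preimage_sub_le μ _ _ b) h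

/-- The edge-vertex entropy inequality for factors of i.i.d. -/
theorem edge_vertex [Nonempty α] {F : (Vertex d → Λ) → α}
    (hF : ∀ a, MeasurableSet (F ⁻¹' {a})) :
    (2 * d - 2) * ent (Measure.infinitePi fun _ : Vertex d => ν) F ≤
      ∑ a, ent (Measure.infinitePi fun _ : Vertex d => ν)
        (fun x => (F x, F fun v => x (flipFun a v))) := by
  set μ := Measure.infinitePi fun _ : Vertex d => ν
  choose F' hF' hμ using fun n : ℕ => exists_quantized_approx (ν := ν) hF
    (ε := 1 / ((n : ℝ) + 1)) (by positivity)
  have hmeas : ∀ n, MeasurableSet {x | F x ≠ F' n x} := by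
    intro n
    have : {x | F x ≠ F' n x} = (⋃ a, F ⁻¹' {a} ∩ F' n ⁻¹' {a})ᶜ := by
      ext x
      simp [eq_comm]
    rw [this]
    exact (MeasurableSet.iUnion fun a => (hF a).inter ((hF' n).measurableSet _)).compl
  have h0 : Tendsto (fun n => μ.real {x | F' n x ≠ F x}) atTop (nhds 0) := by
    simp only [ne_comm (a := F' _ _)]
    exact squeeze_zero (fun _ => measureReal_nonneg) hμ tendsto_one_div_add_atTop_nhds_zero_nat
  have hshift : ∀ a : Fin d, μ.map (fun x v => x (flipFun a v)) = μ := fun a =>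
    Measure.map_infinitePi_infinitePi_of_inj (P := fun _ : Vertex d => ν)
      (Function.Involutive.injective (flipFun_flipFun a))
  have h1 : ∀ a : Fin d, Tendsto (fun n => μ.real {x | (F' n x, F' n fun v => x (flipFun a v)) ≠
      (F x, F fun v => x (flipFun a v))}) atTop (nhds 0) := by
    intro a
    refine squeeze_zero (fun _ => measureReal_nonneg) (fun n => ?_)
      (by simpa using h0.add h0)
    have e : μ.real {x | (F' n fun v => x (flipFun a v)) ≠ F fun v => x (flipFun a v)} =
        μ.real {x | F' n x ≠ F x} := by
      -- The reflection preserves the product law, so the error at the neighbour equals the error at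
      -- the root.
      have hm : MeasurableSet {x | F' n x ≠ F x} := by
        simpa only [ne_comm] using hmeas n
      conv_rhs => rw [← hshift a]
      rw [map_measureReal_apply (by fun_prop) hm]
      rfl
    refine (measureReal_mono (s₂ := {x | F' n x ≠ F x} ∪
      {x | (F' n fun v => x (flipFun a v)) ≠ F fun v => x (flipFun a v)}) ?_
      (measure_ne_top _ _)).trans
      ((measureReal_union_le _ _).trans (by rw [e]))
    intro x hx
    by_contra h
    simp only [Set.mem_union, Set.mem_ofPred_eq, not_or, not_not] at h
    exact hx (Prod.ext h.1 h.2)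
  refine le_of_tendsto_of_tendsto' ((tendsto_ent h0).const_mul _)
    (tendsto_finsetSum _ fun a _ => tendsto_ent (h1 a)) fun n => (hF' n).edge_vertex

end Approximation

/-! ### Rearranging infinite products -/

section Product

theorem infinitePi_prod_map {ι A B : Type*} [MeasurableSpace A] [MeasurableSpace B]
    (μ : ι → Measure A) (ν : ι → Measure B) [∀ i, IsProbabilityMeasure (μ i)]
    [∀ i, IsProbabilityMeasure (ν i)] :
    ((Measure.infinitePi μ).prod (Measure.infinitePi ν)).map (fun p i => (p.1 i, p.2 i)) =
      Measure.infinitePi fun i => (μ i).prod (ν i) := by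
  refine Measure.eq_infinitePi _ fun s t ht => ?_
  have hm : MeasurableSet ((Set.univ : Set s).pi fun i => t i) :=
    MeasurableSet.univ_pi fun i => ht i
  have h1 : ((Measure.infinitePi μ).prod (Measure.infinitePi ν)).map
      (Prod.map s.restrict s.restrict) =
      (Measure.pi fun i : s => μ i).prod (Measure.pi fun i : s => ν i) := by
    rw [← Measure.map_prod_map _ _ (by fun_prop) (by fun_prop), Measure.infinitePi_map_restrict,
      Measure.infinitePi_map_restrict]
  have h2 := (measurePreserving_arrowProdEquivProdArrow A B s (fun i => μ i)
    (fun i => ν i)).symm.map_eq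
  rw [Measure.map_apply (by fun_prop) (MeasurableSet.pi s.countable_toSet fun i _ => ht i)]
  have h3 : (fun (p : (ι → A) × (ι → B)) i => (p.1 i, p.2 i)) ⁻¹' (s : Set ι).pi t =
      Prod.map s.restrict s.restrict ⁻¹' ((MeasurableEquiv.arrowProdEquivProdArrow A B s).symm ⁻¹'
        ((Set.univ : Set s).pi fun i => t i)) := by
    ext p
    simp only [Set.mem_preimage, Set.mem_pi, Set.mem_univ, true_imp_iff, Subtype.forall]
    rfl
  rw [h3, ← Measure.map_apply (by fun_prop) ((MeasurableEquiv.measurable _) hm), h1,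
    ← Measure.map_apply (MeasurableEquiv.measurable _) hm, h2, Measure.pi_pi]
  exact Finset.prod_coe_sort s fun i => ((μ i).prod (ν i)) (t i)

theorem infinitePi_map_transpose {ι κ A : Type*} [MeasurableSpace A] (μ : Measure A)
    [IsProbabilityMeasure μ] :
    (Measure.infinitePi fun _ : ι => Measure.infinitePi fun _ : κ => μ).map
      (fun x j i => x i j) = Measure.infinitePi fun _ : κ => Measure.infinitePi fun _ : ι => μ := by
  have h1 := Measure.infinitePi_map_curry_symm (fun (_ : ι) (_ : κ) => μ)
  have h2 := Measure.infinitePi_map_curry (fun (_ : κ) (_ : ι) => μ)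
  have h3 := Measure.map_infinitePi_infinitePi_of_inj (P := fun _ : ι × κ => μ)
    (f := Prod.swap) (Prod.swap_injective (α := κ) (β := ι))
  rw [← h2, ← h3, ← h1, Measure.map_map (by fun_prop) (by fun_prop),
    Measure.map_map (by fun_prop) (by fun_prop)]
  rfl

end Product

/-! ### The correlated copies as one factor of i.i.d. -/

section Coupling

open unitInterval in
/-- The Bernoulli law of parameter `p`. -/
def coin (p : unitInterval) : Measure Prop :=
  toNNReal p • Measure.dirac True + toNNReal (σ p) • Measure.dirac False

instance (p : unitInterval) : IsProbabilityMeasure (coin p) := by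
  unfold coin; infer_instance

/-- The joint law of the labels at one vertex in all labellings, and of its membership in `S`. -/
def siteLaw (p : unitInterval) : Measure ((ℕ → unitInterval) × Prop) :=
  (Measure.infinitePi fun _ : ℕ => (volume : Measure unitInterval)).prod (coin p)

instance (p : unitInterval) : IsProbabilityMeasure (siteLaw p) := by
  unfold siteLaw; infer_instance

/-- The randomness of the coupling, collected site by site. -/
def sites {d : ℕ} (ω : (ℕ → Labelling d) × Set (Vertex d)) (v : Vertex d) :
    (ℕ → unitInterval) × Prop :=
  (fun i => ω.1 i v, v ∈ ω.2)

theorem measurable_sites {d : ℕ} : Measurable (sites (d := d)) := by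
  unfold sites
  refine measurable_pi_iff.2 fun v => Measurable.prodMk (by fun_prop) ?_
  exact (measurable_set_mem v).comp measurable_snd

/-- This turns the coupling into a single i.i.d. labelling with labels in `(ℕ → unitInterval) ×
Prop`, to which the edge-vertex inequality applies for all copies jointly. -/
theorem couplingLaw_map_sites (d : ℕ) (p : unitInterval) :
    (couplingLaw d p).map sites = Measure.infinitePi fun _ : Vertex d => siteLaw p := by
  have h1 : (setBernoulli (Set.univ : Set (Vertex d)) p).map (fun s v => v ∈ s) =
      Measure.infinitePi fun _ : Vertex d => coin p := by
    rw [setBernoulli_eq_map, Measure.map_map]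
    · have : (fun (s : Set (Vertex d)) v => v ∈ s) ∘ (fun q : Vertex d → Prop => {i | q i}) = id :=
        rfl
      rw [this, Measure.map_id]
      simp only [Set.mem_univ, coin]
    · exact measurable_pi_iff.2 fun v => measurable_set_mem v
    · exact MeasurableEquiv.setOfPred.measurable
  have h2 := infinitePi_map_transpose (ι := ℕ) (κ := Vertex d) (volume : Measure unitInterval)
  have hm : Measurable fun (s : Set (Vertex d)) v => v ∈ s :=
    measurable_pi_iff.2 fun v => measurable_set_mem v
  have h3 := infinitePi_prod_map (fun _ : Vertex d => Measure.infinitePi fun _ : ℕ =>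
    (volume : Measure unitInterval)) (fun _ : Vertex d => coin p)
  rw [← h1, ← h2, Measure.map_prod_map _ _ (by fun_prop) hm,
    Measure.map_map (by fun_prop) (by fun_prop)] at h3
  exact h3

open Classical in
/-- The label that a site shows in the `i`-th copy. -/
def siteLabel (i : ℕ) (c : (ℕ → unitInterval) × Prop) : unitInterval :=
  if c.2 then c.1 i else c.1 0

theorem copyLabelling_eq {d : ℕ} (ω : (ℕ → Labelling d) × Set (Vertex d)) (i : ℕ) :
    copyLabelling ω i = fun v => siteLabel i (sites ω v) := by
  funext v
  rfl

theorem measurable_siteLabel (i : ℕ) : Measurable (siteLabel i) := by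
  classical
  unfold siteLabel
  exact Measurable.ite (measurable_snd (.of_discrete (s := {q : Prop | q}))) (by fun_prop)
    (by fun_prop)

/-- The shown label is uniform whether or not the site lies in `S`. Hence each copy on its own is
the process of `f` on i.i.d. uniform labels and is almost surely independent. -/
theorem siteLaw_map_siteLabel (p : unitInterval) (i : ℕ) :
    (siteLaw p).map (siteLabel i) = volume := by
  ext B hB
  rw [Measure.map_apply (measurable_siteLabel i) hB]
  have h : siteLabel i ⁻¹' B = ((fun x : ℕ → unitInterval => x i) ⁻¹' B) ×ˢ {True} ∪
      ((fun x : ℕ → unitInterval => x 0) ⁻¹' B) ×ˢ {False} := by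
    ext ⟨x, q⟩
    by_cases hq : q <;> simp [siteLabel, hq]
  have hj : ∀ j : ℕ, (Measure.infinitePi fun _ : ℕ => (volume : Measure unitInterval))
      ((fun x : ℕ → unitInterval => x j) ⁻¹' B) = volume B := by
    intro j
    rw [← Measure.map_apply (by fun_prop) hB,
      Measure.infinitePi_map_eval (fun _ : ℕ => (volume : Measure unitInterval)) j]
  have hd : Disjoint (((fun x : ℕ → unitInterval => x i) ⁻¹' B) ×ˢ ({True} : Set Prop))
      (((fun x : ℕ → unitInterval => x 0) ⁻¹' B) ×ˢ ({False} : Set Prop)) := by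
    rw [Set.disjoint_left]
    rintro ⟨x, q⟩ ⟨_, h1⟩ ⟨_, h2⟩
    simp_all
  have hc : coin p {True} + coin p {False} = 1 := by
    rw [← measure_union (by simp) .of_discrete, ← measure_univ (μ := coin p)]
    congr 1
    ext q
    by_cases hq : q <;> simp [hq]
  rw [h, measure_union hd ((hB.preimage (by fun_prop)).prod .of_discrete), siteLaw,
    Measure.prod_prod, Measure.prod_prod, hj, hj, ← mul_add, hc, mul_one]

theorem map_siteLabel_eq_labelLaw (d : ℕ) (p : unitInterval) (i : ℕ) :
    (Measure.infinitePi fun _ : Vertex d => siteLaw p).map (fun x v => siteLabel i (x v)) =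
      labelLaw d := by
  rw [Measure.infinitePi_map_pi (μ := fun _ : Vertex d => siteLaw p) fun _ =>
    measurable_siteLabel i, labelLaw]
  simp only [siteLaw_map_siteLabel]

theorem root_mem_process_iff {d : ℕ} {f : Labelling d → Bool} (hf : IsFactor f)
    (x : Labelling d) : root d ∈ process f x ↔ f x = true :=
  mem_process_iff hf SimpleGraph.Iso.refl rfl x

theorem ae_not_adjacent {d : ℕ} {f : Labelling d → Bool} (hf : IsIndepFactor f) (a : Fin d) :
    ∀ᵐ x ∂labelLaw d, ¬ (f x = true ∧ f (fun v => x (flipFun a v)) = true) := by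
  filter_upwards [hf.indep] with x hx
  rintro ⟨h1, h2⟩
  have r1 : root d ∈ process f x := (root_mem_process_iff hf.toIsFactor x).2 h1
  have e : edgeFlip a (flipFun a (root d)) = root d :=
    flipFun_flipFun a (root d)
  have r2 : flipFun a (root d) ∈ process f x :=
    (mem_process_iff hf.toIsFactor (edgeFlip a) e x).2 h2
  have hadj : (tree d).Adj (root d) (flipFun a (root d)) := Or.inl ⟨a, rfl⟩
  exact hx r1 r2 hadj.ne hadj

/-- The set of those among the first `k` copies that contain the root. -/
def rootColor {d : ℕ} (f : Labelling d → Bool) (k : ℕ)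
    (x : Vertex d → (ℕ → unitInterval) × Prop) : Finset (Fin k) :=
  {j | f (fun v => siteLabel (j + 1) (x v)) = true}

variable {d : ℕ} {f : Labelling d → Bool}

theorem measurable_label (hf : Measurable f) (i : ℕ) :
    Measurable fun x : Vertex d → (ℕ → unitInterval) × Prop =>
      f (fun v => siteLabel i (x v)) :=
  hf.comp (measurable_pi_iff.2 fun v => (measurable_siteLabel i).comp (measurable_pi_apply v))

theorem measurableSet_rootColor (hf : Measurable f) (k : ℕ) (B : Set (Finset (Fin k))) :
    MeasurableSet (rootColor f k ⁻¹' B) := by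
  have hg : Measurable fun (x : Vertex d → (ℕ → unitInterval) × Prop) (j : Fin k) =>
      f (fun v => siteLabel (j + 1) (x v)) :=
    measurable_pi_iff.2 fun j => measurable_label hf _
  exact hg (.of_discrete (s := (fun u : Fin k → Bool => ({j | u j = true} : Finset (Fin k))) ⁻¹' B))

/-- A common index `j` would put both ends of an edge into the copy `j + 1`. -/
theorem rootColor_pair_null (hf : IsIndepFactor f) (k : ℕ) (p : unitInterval) (a : Fin d)
    {S T : Finset (Fin k)} (hST : ¬ Disjoint S T) :
    (Measure.infinitePi fun _ : Vertex d => siteLaw p).real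
      ((fun x => (rootColor f k x, rootColor f k fun v => x (flipFun a v))) ⁻¹' {(S, T)}) = 0 := by
  obtain ⟨j, hS, hT⟩ := Finset.not_disjoint_iff.1 hST
  have h1 := ae_not_adjacent hf a
  rw [← map_siteLabel_eq_labelLaw d p (j + 1)] at h1
  have h2 := ae_of_ae_map (by
    exact (measurable_pi_iff.2 fun v => (measurable_siteLabel _).comp
      (measurable_pi_apply v)).aemeasurable) h1
  rw [measureReal_def, measure_mono_null _ (ae_iff.1 h2), ENNReal.toReal_zero]
  intro x hx
  simp only [Set.mem_preimage, Set.mem_singleton_iff, Prod.mk.injEq] at hx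
  rw [Set.mem_ofPred_eq, not_not]
  rw [← hx.1] at hS
  rw [← hx.2] at hT
  exact ⟨(Finset.mem_filter.1 hS).2, (Finset.mem_filter.1 hT).2⟩

theorem interDensity_eq (hf : IsFactor f) (p : unitInterval) (i : ℕ) :
    interDensity f p i = (Measure.infinitePi fun _ : Vertex d => siteLaw p).real
      {x | ∀ j ∈ Finset.Icc 1 i, f (fun v => siteLabel j (x v)) = true} := by
  have hm : MeasurableSet {x : Vertex d → (ℕ → unitInterval) × Prop |
      ∀ j ∈ Finset.Icc 1 i, f (fun v => siteLabel j (x v)) = true} := by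
    simp only [Set.ofPred_forall]
    exact MeasurableSet.biInter (Finset.countable_toSet _) fun j _ =>
      measurable_label hf.measurable j (.of_discrete (s := {true}))
  rw [← couplingLaw_map_sites, map_measureReal_apply measurable_sites hm, interDensity]
  congr 1
  ext ω
  simp only [Set.mem_iInter, Set.mem_ofPred_eq, Set.mem_preimage, copy, root_mem_process_iff hf,
    copyLabelling_eq]

/-- An injection of the labels that fixes `0` and maps `{1, …, |T|}` onto `T + 1`. -/
theorem exists_label_injection {k : ℕ} (T : Finset (Fin k)) : ∃ e : ℕ → ℕ,
    Function.Injective e ∧ e 0 = 0 ∧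
      (Finset.Icc 1 T.card).image e = T.image fun j : Fin k => (j : ℕ) + 1 := by
  -- Beyond `T.card` the values are at least `k`, so they avoid the elements of `T`.
  set g : ℕ → ℕ := fun j => if h : j < T.card then (T.orderEmbOfFin rfl ⟨j, h⟩ : ℕ) else k + j
  have hg : Function.Injective g := by
    intro a b hab
    simp only [g] at hab
    split_ifs at hab with h1 h2 h2
    · have := (T.orderEmbOfFin rfl).injective (Fin.ext hab)
      simpa using this
    · have := (T.orderEmbOfFin rfl ⟨a, h1⟩).2
      omega
    · have := (T.orderEmbOfFin rfl ⟨b, h2⟩).2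
      omega
    · omega
  -- The shift by one leaves out the index `0`, which belongs to the labelling shared by all copies.
  refine ⟨fun j => if j = 0 then 0 else g (j - 1) + 1, ?_, by simp, ?_⟩
  · intro a b hab
    simp only at hab
    split_ifs at hab with h1 h2 h2
    · omega
    · have := hg (Nat.succ_injective hab)
      omega
  · ext n
    simp only [Finset.mem_image, Finset.mem_Icc]
    constructor
    · rintro ⟨j, ⟨h1, h2⟩, rfl⟩
      have hj : j - 1 < T.card := by omega
      refine ⟨T.orderEmbOfFin rfl ⟨j - 1, hj⟩, T.orderEmbOfFin_mem rfl _, ?_⟩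
      rw [if_neg (by omega)]
      simp only [g, dif_pos hj]
    · rintro ⟨j, hj, rfl⟩
      have : j ∈ Set.range (T.orderEmbOfFin rfl) := by
        rw [Finset.range_orderEmbOfFin]; exact hj
      obtain ⟨⟨i, hi⟩, rfl⟩ := this
      refine ⟨i + 1, ⟨by omega, by omega⟩, ?_⟩
      rw [if_neg (by omega)]
      simp only [Nat.add_sub_cancel, g, dif_pos hi]

/-- Exchangeability of the copies. -/
theorem real_subset_rootColor (hf : IsFactor f) (p : unitInterval) {k : ℕ}
    (T : Finset (Fin k)) :
    (Measure.infinitePi fun _ : Vertex d => siteLaw p).real {x | T ⊆ rootColor f k x} =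
      interDensity f p T.card := by
  obtain ⟨e, he, he0, heT⟩ := exists_label_injection T
  have h1 : (siteLaw p).map (Prod.map (fun x i => x (e i)) id) = siteLaw p := by
    rw [siteLaw, ← Measure.map_prod_map _ _ (by fun_prop) (by fun_prop), Measure.map_id,
      Measure.map_infinitePi_infinitePi_of_inj
        (P := fun _ : ℕ => (volume : Measure unitInterval)) he]
  have hm1 : Measurable (Prod.map (fun (x : ℕ → unitInterval) i => x (e i)) (id : Prop → Prop)) :=
    by fun_prop
  have h2 := Measure.infinitePi_map_pi (μ := fun _ : Vertex d => siteLaw p)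
    (f := fun _ => Prod.map (fun x i => x (e i)) id) fun _ => hm1
  simp only [h1] at h2
  have hm : MeasurableSet {x : Vertex d → (ℕ → unitInterval) × Prop |
      ∀ j ∈ Finset.Icc 1 T.card, f (fun v => siteLabel j (x v)) = true} := by
    simp only [Set.ofPred_forall]
    exact MeasurableSet.biInter (Finset.countable_toSet _) fun j _ =>
      measurable_label hf.measurable j (.of_discrete (s := {true}))
  rw [interDensity_eq hf]
  conv_rhs => rw [← h2]
  rw [map_measureReal_apply (by fun_prop) hm]
  congr 1
  ext x
  have hl : ∀ j c, siteLabel j (Prod.map (fun x i => x (e i)) id c) = siteLabel (e j) c := by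
    intro j c
    simp only [siteLabel, Prod.map, id, he0]
  simp only [Set.mem_ofPred_eq, Set.mem_preimage, hl]
  have : (∀ j ∈ Finset.Icc 1 T.card, f (fun v => siteLabel (e j) (x v)) = true) ↔
      ∀ j ∈ (Finset.Icc 1 T.card).image e, f (fun v => siteLabel j (x v)) = true := by
    simp only [Finset.forall_mem_image]
  rw [this, heT]
  simp only [Finset.forall_mem_image, Finset.subset_iff, rootColor, Finset.mem_filter,
    Finset.mem_univ, true_and]

end Coupling

/-! ### Mutual information forced by forbidden pairs -/

section Gibbs

variable {Ω α : Type*} [MeasurableSpace Ω] [Fintype α] {μ : Measure Ω} [IsProbabilityMeasure μ]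

open Classical in
/-- Two random variables that avoid a set of pairs of values have large mutual information. -/
theorem ent_pair_le_sub (X Y : Ω → α)
    (hm : ∀ q, MeasurableSet ((fun ω => (X ω, Y ω)) ⁻¹' {q})) (R : α → α → Prop)
    (hR : ∀ s t, R s t → μ.real ((fun ω => (X ω, Y ω)) ⁻¹' {(s, t)}) = 0) :
    ent μ (fun ω => (X ω, Y ω)) ≤ ent μ X + ent μ Y -
      ∑ s, ∑ t, if R s t then μ.real (X ⁻¹' {s}) * μ.real (Y ⁻¹' {t}) else 0 := by
  set p : α → α → ℝ := fun s t => μ.real ((fun ω => (X ω, Y ω)) ⁻¹' {(s, t)}) with hp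
  set u : α → ℝ := fun s => μ.real (X ⁻¹' {s}) with hu
  set w : α → ℝ := fun t => μ.real (Y ⁻¹' {t}) with hw
  have hpu : ∀ s, ∑ t, p s t = u s := fun s => sum_real_preimage_pair hm s
  have hpw : ∀ t, ∑ s, p s t = w t := fun t => sum_real_preimage_pair' hm t
  have hp0 : ∀ s t, 0 ≤ p s t := fun _ _ => measureReal_nonneg
  have hle1 : ∀ s t, p s t ≤ u s := fun s t => hpu s ▸
    Finset.single_le_sum (f := fun t => p s t) (fun t _ => hp0 s t) (Finset.mem_univ t)
  have hle2 : ∀ s t, p s t ≤ w t := fun s t => hpw t ▸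
    Finset.single_le_sum (f := fun s => p s t) (fun s _ => hp0 s t) (Finset.mem_univ s)
  have hsum : ∑ s, ∑ t, p s t = 1 := by
    rw [← sum_real_preimage hm (μ := μ), Fintype.sum_prod_type]
  have hu1 : ∑ s, u s = 1 := by simp only [← hpu, hsum]
  have hw1 : ∑ t, w t = 1 := by simp only [← hpw]; rw [Finset.sum_comm, hsum]
  -- Gibbs' inequality against the product law, restricted to the allowed pairs: both laws have mass
  -- one, so summation leaves the product mass of the forbidden pairs.
  have key : ∀ s t, p s t - u s * w t + (if R s t then u s * w t else 0) ≤
      p s t * Real.log (p s t) - p s t * Real.log (u s) - p s t * Real.log (w t) := by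
    intro s t
    by_cases h : R s t
    · have : p s t = 0 := hR s t h
      simp [h, this]
    · rw [if_neg h, add_zero]
      rcases (hp0 s t).eq_or_lt with h0 | h0
      · rw [← h0]
        have : 0 ≤ u s * w t := mul_nonneg measureReal_nonneg measureReal_nonneg
        simpa using this
      · have a1 : 0 < u s := h0.trans_le (hle1 s t)
        have a2 : 0 < w t := h0.trans_le (hle2 s t)
        have := mul_log_ratio_ge h0.le (mul_pos a1 a2).le fun h => absurd h (mul_pos a1 a2).ne'
        rw [Real.log_mul a1.ne' a2.ne'] at this
        linarith
  have hs := Finset.sum_le_sum fun s (_ : s ∈ Finset.univ) => Finset.sum_le_sum fun t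
    (_ : t ∈ Finset.univ) => key s t
  simp only [Finset.sum_add_distrib, Finset.sum_sub_distrib, hsum, ← Finset.mul_sum, hw1, hu1,
    mul_one] at hs
  have e1 : ∑ s, ∑ t, p s t * Real.log (u s) = - ent μ X := by
    simp only [← Finset.sum_mul, hpu, ent, Real.negMulLog, neg_mul, Finset.sum_neg_distrib,
      neg_neg, hu]
  have e2 : ∑ s, ∑ t, p s t * Real.log (w t) = - ent μ Y := by
    rw [Finset.sum_comm]
    simp only [← Finset.sum_mul, hpw, ent, Real.negMulLog, neg_mul, Finset.sum_neg_distrib,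
      neg_neg, hw]
  have e3 : ∑ s, ∑ t, p s t * Real.log (p s t) = - ent μ (fun ω => (X ω, Y ω)) := by
    simp only [ent, Fintype.sum_prod_type, Real.negMulLog, neg_mul, Finset.sum_neg_distrib,
      neg_neg, hp]
  rw [e1, e2, e3] at hs
  linarith

end Gibbs

/-! ### From entropy to normalized densities -/

section Asymptotics

variable {α : Type*} [Fintype α] [DecidableEq α]

theorem negMulLog_le_one_sub {x : ℝ} (hx : 0 ≤ x) : Real.negMulLog x ≤ 1 - x := by
  have := mul_log_ratio_ge hx zero_le_one (by simp)
  simp only [Real.log_one, sub_zero] at this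
  rw [Real.negMulLog]
  linarith

open Classical in
/-- The passage from the entropy bound to the bound on normalized densities. -/
theorem normalized_bound {d : ℝ} (hL : 1 ≤ Real.log d) (hd : 0 < d) (π : α → ℝ)
    (hπ : ∀ s, 0 ≤ π s) (hπ1 : ∑ s, π s = 1) (o : α) (R : α → α → Prop)
    (hR : ∀ s, s ≠ o → R s s)
    (h : d * (∑ s, ∑ t, if R s t then π s * π t else 0) ≤ 2 * ∑ s, Real.negMulLog (π s)) :
    -(12 * Fintype.card α) / Real.log d ≤
      2 * (∑ s ∈ Finset.univ.erase o, π s / (Real.log d / d)) -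
        ∑ s, ∑ t, if R s t then (π s / (Real.log d / d)) * (π t / (Real.log d / d)) else 0 := by
  set L := Real.log d with hLdef
  set c := L / d with hc
  have hL0 : 0 < L := by linarith
  have hc0 : 0 < c := div_pos hL0 hd
  set β : α → ℝ := fun s => π s / c with hβ
  have hβ0 : ∀ s, 0 ≤ β s := fun s => div_nonneg (hπ s) hc0.le
  have hπβ : ∀ s, π s = c * β s := fun s => by simp only [hβ]; field_simp
  set U := ∑ s ∈ Finset.univ.erase o, β s with hU
  set Q := ∑ s, ∑ t, if R s t then β s * β t else 0 with hQ
  set N : ℝ := (Fintype.card α : ℝ) with hN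
  have hU0 : 0 ≤ U := Finset.sum_nonneg fun s _ => hβ0 s
  have hN1 : 1 ≤ N := by
    rw [hN]; exact_mod_cast Fintype.card_pos_iff.2 ⟨o⟩
  have hcard : ((Finset.univ.erase o).card : ℝ) ≤ N := by
    rw [hN]; exact_mod_cast Finset.card_le_univ _
  have hB : ∑ s, ∑ t, (if R s t then π s * π t else 0) = c ^ 2 * Q := by
    rw [hQ, Finset.mul_sum]
    refine Finset.sum_congr rfl fun s _ => ?_
    rw [Finset.mul_sum]
    refine Finset.sum_congr rfl fun t _ => ?_
    rw [hπβ s, hπβ t]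
    split_ifs <;> ring
  have hπo : 1 - π o = c * U := by
    rw [← hπ1, ← Finset.add_sum_erase _ _ (Finset.mem_univ o), hU, Finset.mul_sum]
    simp only [hπβ]; ring
  -- `negMulLog (c * b)` splits as `b * negMulLog c + c * negMulLog b`, and `-log c = L - log L ≤
  -- L`.
  have hneg : ∀ s, Real.negMulLog (π s) ≤ c * L * β s + c := by
    intro s
    rw [hπβ s, Real.negMulLog_mul]
    have h1 : Real.negMulLog c ≤ c * L := by
      rw [Real.negMulLog, hc, Real.log_div hL0.ne' hd.ne', ← hLdef, ← hc]
      have := Real.log_nonneg hL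
      nlinarith
    have h2 : Real.negMulLog (β s) ≤ 1 := (negMulLog_le_one_sub (hβ0 s)).trans (by
      linarith [hβ0 s])
    nlinarith [mul_le_mul_of_nonneg_left h1 (hβ0 s), mul_le_mul_of_nonneg_left h2 hc0.le]
  have hH : ∑ s, Real.negMulLog (π s) ≤ c * (L * U + N + U) := by
    rw [← Finset.add_sum_erase _ _ (Finset.mem_univ o)]
    -- The dominant value `o` contributes only `1 - π o = c * U`, with no factor `L`.
    have h1 := negMulLog_le_one_sub (hπ o)
    have h2 := Finset.sum_le_sum fun s (_ : s ∈ Finset.univ.erase o) => hneg s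
    rw [Finset.sum_add_distrib, ← Finset.mul_sum, Finset.sum_const, nsmul_eq_mul] at h2
    have h3 := mul_le_mul_of_nonneg_right hcard hc0.le
    rw [← hU] at h2
    linarith
  have hmain : L * Q ≤ 2 * L * U + 2 * N + 2 * U := by
    rw [hB] at h
    have h1 : d * (c ^ 2 * Q) = c * (L * Q) := by rw [hc]; field_simp
    have h2 : c * (L * Q) ≤ c * (2 * L * U + 2 * N + 2 * U) := by
      rw [← h1]; linarith
    exact le_of_mul_le_mul_left h2 hc0
  -- Cauchy-Schwarz together with the diagonal pairs, which `hR` makes forbidden.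
  have hUQ : U ^ 2 ≤ N * Q := by
    have h1 := sq_sum_le_card_mul_sum_sq (s := Finset.univ.erase o) (f := β)
    have h2 : ∑ s ∈ Finset.univ.erase o, β s ^ 2 ≤ Q := by
      have h3 : ∑ s ∈ Finset.univ.erase o, β s ^ 2 ≤
          ∑ s ∈ Finset.univ.erase o, ∑ t, if R s t then β s * β t else 0 := by
        refine Finset.sum_le_sum fun s hs => ?_
        refine le_trans (le_of_eq ?_) (Finset.single_le_sum
          (f := fun t => if R s t then β s * β t else 0) (fun t _ => ?_) (Finset.mem_univ s))
        · rw [if_pos (hR s (Finset.ne_of_mem_erase hs)), sq]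
        · split_ifs
          exacts [mul_nonneg (hβ0 s) (hβ0 t), le_rfl]
      refine h3.trans (Finset.sum_le_sum_of_subset_of_nonneg (Finset.erase_subset _ _) ?_)
      intro s _ _
      refine Finset.sum_nonneg fun t _ => ?_
      split_ifs
      exacts [mul_nonneg (hβ0 s) (hβ0 t), le_rfl]
    refine h1.trans ?_
    refine mul_le_mul hcard h2 (Finset.sum_nonneg fun _ _ => sq_nonneg _) (by linarith)
  -- With `L ≥ 1` the previous bounds give `U² ≤ N (4U + 2N)`, which fails for `U > 5N`.
  have hUN : U ≤ 5 * N := by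
    by_contra hcon
    have hcon : 5 * N < U := not_le.1 hcon
    have h1 : L * U ^ 2 ≤ N * (2 * L * U + 2 * N + 2 * U) := by
      calc L * U ^ 2 ≤ L * (N * Q) := mul_le_mul_of_nonneg_left hUQ hL0.le
        _ = N * (L * Q) := by ring
        _ ≤ _ := mul_le_mul_of_nonneg_left hmain (by linarith)
    have h2 : N * (2 * L * U + 2 * N + 2 * U) ≤ L * (N * (4 * U + 2 * N)) := by
      have : 0 ≤ (L - 1) * (N * (2 * U + 2 * N)) :=
        mul_nonneg (by linarith) (mul_nonneg (by linarith) (by linarith))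
      nlinarith
    have h3 : U ^ 2 ≤ N * (4 * U + 2 * N) := le_of_mul_le_mul_left (h1.trans h2) hL0
    nlinarith [mul_pos (by linarith : 0 < N) (by linarith : 0 < U - 5 * N)]
  rw [div_le_iff₀ hL0]
  -- The constant is `12 N = 2 N + 2 * (5 N)`, from `hmain` and `U ≤ 5 N`.
  nlinarith

end Asymptotics

/-! ### Inclusion-exclusion -/

section InclusionExclusion

variable {k : ℕ}

theorem sum_neg_one_pow_card_of_subset (S : Finset (Fin k)) :
    ∑ T, (if T ⊆ S then (-1 : ℝ) ^ T.card else 0) = if S = ∅ then 1 else 0 := by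
  rw [← Finset.sum_filter]
  have h : Finset.univ.filter (fun T => T ⊆ S) = S.powerset := by
    ext T; simp
  rw [h]
  have := congrArg (fun z : ℤ => (z : ℝ)) (Finset.sum_powerset_neg_one_pow_card (x := S))
  push_cast at this
  exact this

/-- Inclusion-exclusion, for the union and for the coincidences of two independent copies. -/
theorem sum_choose_eq (β : Finset (Fin k) → ℝ) (a : ℕ → ℝ)
    (ha : ∀ T : Finset (Fin k), a T.card = ∑ S, if T ⊆ S then β S else 0) :
    ∑ i ∈ Finset.Icc 1 k, (-1 : ℝ) ^ (i - 1) * (k.choose i : ℝ) * (a i * (2 - a i)) =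
      2 * (∑ S ∈ Finset.univ.erase ∅, β S) -
        ∑ S, ∑ T, if ¬ Disjoint S T then β S * β T else 0 := by
  set g : ℕ → ℝ := fun i => a i * (2 - a i) with hg
  have h1 : ∑ i ∈ Finset.Icc 1 k, (-1 : ℝ) ^ (i - 1) * (k.choose i : ℝ) * g i =
      -- The term `i = 0` is added and subtracted so that the sum runs over all subsets of `Fin k`.
      g 0 - ∑ i ∈ Finset.range (k + 1), k.choose i • ((-1 : ℝ) ^ i * g i) := by
    rw [Finset.sum_range_succ', Finset.range_eq_Ico, Finset.sum_Ico_add' (fun i =>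
      k.choose i • ((-1 : ℝ) ^ i * g i)) 0 k 1]
    have : Finset.Ico (0 + 1) (k + 1) = Finset.Icc 1 k := by ext; simp
    rw [this]
    simp only [Nat.choose_zero_right, pow_zero, one_mul, one_smul]
    rw [sub_add_eq_sub_sub_swap, sub_self, zero_sub, ← Finset.sum_neg_distrib]
    refine Finset.sum_congr rfl fun i hi => ?_
    obtain ⟨j, rfl⟩ : ∃ j, i = j + 1 := ⟨i - 1, by simp at hi; omega⟩
    simp only [Nat.add_sub_cancel, nsmul_eq_mul, pow_succ]
    ring
  have h2 : ∑ i ∈ Finset.range (k + 1), k.choose i • ((-1 : ℝ) ^ i * g i) =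
      ∑ T : Finset (Fin k), (-1 : ℝ) ^ T.card * g T.card := by
    have := Finset.sum_powerset_apply_card (fun i => (-1 : ℝ) ^ i * g i)
      (x := (Finset.univ : Finset (Fin k)))
    simp only [Finset.card_univ, Fintype.card_fin, Finset.powerset_univ] at this
    exact this.symm
  have hA : ∑ T : Finset (Fin k), (-1 : ℝ) ^ T.card * a T.card = β ∅ := by
    simp only [ha, Finset.mul_sum]
    rw [Finset.sum_comm]
    have : ∀ S : Finset (Fin k), ∑ T : Finset (Fin k),
        (-1 : ℝ) ^ T.card * (if T ⊆ S then β S else 0) = if S = ∅ then β S else 0 := by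
      intro S
      have := congrArg (fun z => z * β S) (sum_neg_one_pow_card_of_subset S)
      simp only [Finset.sum_mul, ite_mul, zero_mul, one_mul] at this
      rw [← this]
      exact Finset.sum_congr rfl fun T _ => by split_ifs <;> simp
    simp only [this]
    simp
  have hA2 : ∑ T : Finset (Fin k), (-1 : ℝ) ^ T.card * a T.card ^ 2 =
      ∑ S, ∑ S', if Disjoint S S' then β S * β S' else 0 := by
    -- A pair `(S, S')` is counted by the `T ⊆ S ∩ S'`, whose signs cancel unless `S` and `S'` are
    -- disjoint.
    have e : ∀ T : Finset (Fin k), (-1 : ℝ) ^ T.card * a T.card ^ 2 =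
        ∑ S, ∑ S', (if T ⊆ S ∩ S' then (-1 : ℝ) ^ T.card else 0) * (β S * β S') := by
      intro T
      rw [sq, ha, Finset.sum_mul_sum, Finset.mul_sum]
      refine Finset.sum_congr rfl fun S _ => ?_
      rw [Finset.mul_sum]
      refine Finset.sum_congr rfl fun S' _ => ?_
      simp only [Finset.subset_inter_iff]
      by_cases h : T ⊆ S <;> by_cases h' : T ⊆ S' <;> simp [h, h']
    simp only [e]
    rw [Finset.sum_comm]
    refine Finset.sum_congr rfl fun S _ => ?_
    rw [Finset.sum_comm]
    refine Finset.sum_congr rfl fun S' _ => ?_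
    rw [← Finset.sum_mul, sum_neg_one_pow_card_of_subset, ite_mul, one_mul, zero_mul]
    simp only [Finset.disjoint_iff_inter_eq_empty]
  have h3 : ∑ T : Finset (Fin k), (-1 : ℝ) ^ T.card * g T.card =
      2 * β ∅ - ∑ S, ∑ S', if Disjoint S S' then β S * β S' else 0 := by
    rw [← hA, ← hA2, Finset.mul_sum, ← Finset.sum_sub_distrib]
    exact Finset.sum_congr rfl fun T _ => by simp only [hg]; ring
  have h0 : a 0 = ∑ S, β S := by
    have := ha ∅
    simpa using this
  have hsplit : (∑ S, β S) * (∑ S, β S) =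
      (∑ S, ∑ S', if Disjoint S S' then β S * β S' else 0) +
        ∑ S, ∑ T, if ¬ Disjoint S T then β S * β T else 0 := by
    rw [Finset.sum_mul_sum]
    simp only [← Finset.sum_add_distrib]
    exact Finset.sum_congr rfl fun S _ => Finset.sum_congr rfl fun T _ => by
      split_ifs <;> simp
  have herase := Finset.add_sum_erase Finset.univ β (Finset.mem_univ ∅)
  rw [h1, h2, h3]
  simp only [hg, h0]
  linarith

end InclusionExclusion

/-! ### Assembling the bound -/

theorem alternating_sum_ge {d : ℕ} {f : Labelling d → Bool} (hf : IsIndepFactor f) (k : ℕ)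
    (p : unitInterval) (hd : 1 ≤ Real.log d) :
    -(12 * Fintype.card (Finset (Fin k))) / Real.log d ≤
      ∑ i ∈ Finset.Icc 1 k, (-1 : ℝ) ^ (i - 1) * (k.choose i : ℝ) *
        (alpha f p i * (2 - alpha f p i)) := by
  classical
  have hd0 : (0 : ℝ) < d := by
    rcases Nat.eq_zero_or_pos d with rfl | h
    · simp at hd; linarith
    · exact_mod_cast h
  set μ := Measure.infinitePi fun _ : Vertex d => siteLaw p with hμ
  set F := rootColor f k with hF
  have hmeas := measurableSet_rootColor (d := d) hf.measurable k
  have hshift : ∀ a : Fin d, μ.map (fun x v => x (flipFun a v)) = μ := fun a =>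
    Measure.map_infinitePi_infinitePi_of_inj (P := fun _ : Vertex d => siteLaw p)
      (Function.Involutive.injective (flipFun_flipFun a))
  have hlaw : ∀ (a : Fin d) S, μ.real ((fun x => F fun v => x (flipFun a v)) ⁻¹' {S}) =
      μ.real (F ⁻¹' {S}) := by
    intro a S
    conv_rhs => rw [← hshift a]
    rw [map_measureReal_apply (by fun_prop) (hmeas _)]
    rfl
  have hpair : ∀ a : Fin d, ent μ (fun x => (F x, F fun v => x (flipFun a v))) ≤
      2 * ent μ F - ∑ S, ∑ T, if ¬ Disjoint S T then μ.real (F ⁻¹' {S}) * μ.real (F ⁻¹' {T})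
        else 0 := by
    intro a
    have h := ent_pair_le_sub (μ := μ) F (fun x => F fun v => x (flipFun a v)) ?_
      (fun S T => ¬ Disjoint S T) (fun S T h => rootColor_pair_null hf k p a h)
    · have e : ent μ (fun x => F fun v => x (flipFun a v)) = ent μ F := by
        simp only [ent, hlaw]
      rw [e] at h
      simp only [hlaw] at h
      refine h.trans (le_of_eq ?_)
      rw [two_mul]
    · rintro ⟨S, T⟩
      have : (fun x => (F x, F fun v => x (flipFun a v))) ⁻¹' {(S, T)} =
          F ⁻¹' {S} ∩ (fun x v => x (flipFun a v)) ⁻¹' (F ⁻¹' {T}) := by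
        ext x; simp
      rw [this]
      refine (hmeas _).inter ((hmeas _).preimage (by fun_prop))
  have hev := edge_vertex (ν := siteLaw p) fun S => hmeas {S}
  have hB := hev.trans (Finset.sum_le_sum fun a _ => hpair a)
  rw [Finset.sum_const, Finset.card_univ, Fintype.card_fin, nsmul_eq_mul] at hB
  have hnorm := normalized_bound hd hd0 (fun S => μ.real (F ⁻¹' {S}))
    (fun _ => measureReal_nonneg) (sum_real_preimage fun S => hmeas {S}) ∅
    (fun S T => ¬ Disjoint S T) (fun S hS => by simpa using hS) (by
      change _ ≤ 2 * ent μ F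
      have hent : ent (Measure.infinitePi fun _ : Vertex d => siteLaw p) (rootColor f k) =
        ent μ F := rfl
      rw [hent] at hB
      -- Here `2 * d * ent μ F` cancels and the deficit `2 * ent μ F` is what bounds `d * B`.
      have : ∀ B : ℝ, (2 * (d : ℝ) - 2) * ent μ F ≤ d * (2 * ent μ F - B) →
          d * B ≤ 2 * ent μ F := fun B h => by linarith
      refine this _ (hB.trans (le_of_eq ?_))
      congr!)
  rw [sum_choose_eq (fun S => μ.real (F ⁻¹' {S}) / (Real.log d / d))]
  · refine hnorm.trans (le_of_eq ?_)
    congr!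
  · intro T
    rw [alpha, ← real_subset_rootColor hf.toIsFactor p T]
    have h := sum_measureReal_preimage_singleton (μ := μ) (f := F)
      (Finset.univ.filter fun S => T ⊆ S) (fun S _ => hmeas {S})
    have e : F ⁻¹' ↑(Finset.univ.filter fun S => T ⊆ S) = {x | T ⊆ F x} := by
      ext x; simp
    rw [e] at h
    rw [← hμ, ← hF, ← h, Finset.sum_div, Finset.sum_filter]

end FIID

end

theorem theorem2p2 (f : (d : ℕ) → FIID.Labelling d → Bool)
    (hf : ∀ d, FIID.IsIndepFactor (f d)) (k : ℕ) (hk : 1 ≤ k) :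
    (0 : EReal) ≤ Filter.liminf (fun d : ℕ => ⨅ p : unitInterval,
      ((∑ i ∈ Finset.Icc 1 k, (-1 : ℝ) ^ (i - 1) * (k.choose i : ℝ) *
        (FIID.alpha (f d) p i * (2 - FIID.alpha (f d) p i)) : ℝ) : EReal)) Filter.atTop := by
  have hlog : Tendsto (fun d : ℕ => Real.log d) atTop atTop :=
    Real.tendsto_log_atTop.comp tendsto_natCast_atTop_atTop
  have hlim : Tendsto (fun d : ℕ => ((-(12 * Fintype.card (Finset (Fin k))) / Real.log d : ℝ) :
      EReal)) atTop (nhds ((0 : ℝ) : EReal)) :=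
    (continuous_coe_real_ereal.tendsto 0).comp (hlog.const_div_atTop _)
  rw [← EReal.coe_zero, ← hlim.liminf_eq]
  -- The lower bound does not involve `p`, so it survives the infimum.
  refine liminf_le_liminf ?_
  filter_upwards [hlog.eventually_ge_atTop 1] with d hd
  exact le_iInf fun p => EReal.coe_le_coe_iff.2 (FIID.alternating_sum_ge (hf d) k p hd)
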